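/- **Conventions.** Graphs are finite, and loops and multiple edges are allowed. A graph is trivalent if every vertex has exactly three half-edges, and the genus of a connected graph is its first Betti number $|E|-|V|+1$. An automorphism of a graph is a pair of compatible permutations of its vertices and of its half-edges (respecting the pairing of half-edges to edges). **Tropical Hurwitz numbers.** A tropical curve is a connected, finite, trivalent metric graph. Let $E=\mathbb{R}/\ell\mathbb{Z}$, $\ell>0$, be a tropical elliptic curve. A tropical cover $\pi:C\to E$ is a continuous non-constant map from a tropical curve that is affine with integer slope on each edge and balanced: the weight $w_e$ of an edge $e$ is the absolute value of the slope of $\pi|_e$, and at every vertex the weights of the adjacent rays that map to the left of its image add up to the same number as the weights of those that map to the right. Its degree is $\sum_{P\in\pi^{-1}(p)} w_{e_P}$ for any $p\in E$ that is not the image of a vertex, where $e_P$ is the edge that contains $P$; its branch points are the images of the vertices. An isomorphism of covers $\pi:C\to E$, $\pi':C'\to E$ is an isometry $\varphi:C\to C'$ with $\pi'\circ\varphi=\pi$. Let $g>1$ and fix pairwise distinct points $p_1,\dots,p_{2g-2}\in E$. Then $$N^{\mathrm{trop}}_{d,g}:=\sum_{\pi}\frac{1}{|\mathrm{Aut}(\pi)|}\prod_e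 w_e ,$$ where $\pi:C\to E$ runs over the isomorphism classes of tropical covers of degree $d$ whose source has genus $g$ and whose set of branch points is $\{p_1,\dots,p_{2g-2}\}$, and $e$ over the edges of $C$. **Feynman integrals.** Let $\tau$ be in the upper half-plane and $q=e^{\pi i\tau}$. The propagator is $$P(z,q)=\frac1{4\pi^2}\wp(z)+\frac1{12}E_2(q^2),\qquad E_2(q)=1-24\sum_{d\ge1}\sigma_1(d)q^d,$$ with $\wp$ the Weierstrass function of the lattice $\mathbb{Z}+\mathbb{Z}\tau$, where $\wp(0)$ is read as the finite part of $\wp$ at its pole $0$, which is $0$ (this concerns only edges that are loops). A Feynman graph of genus $g$ is a connected trivalent graph $\Gamma$ of genus $g$; label its vertices $x_1,\dots,x_{2g-2}$. For a total order $\Omega$ of the vertices choose real numbers $y_1,\dots,y_{2g-2}$ that are ordered as $\Omega$ says and small in the sense that $|y_i-y_j|<\operatorname{Im}\tau$ for all $i,j$. Let $\gamma_j:[0,1]\to\mathbb{C}$, $t\mapsto iy_j+t$, and set $$I_{\Gamma,\Omega}(q)=\int_{z_j\in\gamma_j}\ \prod_{e}\bigl(-P(z_{a(e)}-z_{b(e)},q)\bigr),\qquad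 I_\Gamma(q)=\sum_{\Omega}I_{\Gamma,\Omega}(q),$$ where $e$ runs over the edges of $\Gamma$, $x_{a(e)}$ and $x_{b(e)}$ are the ends of $e$, and $\Omega$ runs over all $(2g-2)!$ orders of the vertices. **Theorem (tropical curves and integrals).** Let $g>1$. There are only finitely many isomorphism classes of Feynman graphs of genus $g$, and for each $d$ only finitely many isomorphism classes of covers contribute to $N^{\mathrm{trop}}_{d,g}$. For every $\tau$ in the upper half-plane and $q=e^{\pi i\tau}$, for every $\ell>0$, every choice of pairwise distinct points $p_i$ and every choice of the $y_j$ as above, the series on the left converges and $$\sum_{d=1}^{\infty}N^{\mathrm{trop}}_{d,g}\,q^{2d}=\sum_{\Gamma}\frac{1}{|\mathrm{Aut}(\Gamma)|}\,I_\Gamma(q),$$ where $\Gamma$ runs over the isomorphism classes of Feynman graphs of genus $g$. -/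

import Mathlib

noncomputable section

namespace TropMirror

/-! ### Graphs -/

/-- A finite graph, loops and multiple edges allowed. Each edge `e` has the two half-edges
`(e, false)` and `(e, true)`, and `ends e b` is the vertex to which the half-edge `(e, b)` is
attached. (The names `false`, `true` only fix a reference direction of the edge; isomorphisms need
not respect it.) -/
structure Multigraph : Type 1 where
  V : Type
  E : Type
  fintypeV : Fintype V
  fintypeE : Fintype E
  ends : E → Bool → V

attribute [instance] Multigraph.fintypeV Multigraph.fintypeE

namespace Multigraph

/-- Two vertices are joined by an edge. -/
def Joined (G : Multigraph) (v w : G.V) : Prop :=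
  ∃ (e : G.E) (b : Bool), G.ends e b = v ∧ G.ends e (!b) = w

/-- `G` is nonempty and any two vertices are linked by a path. -/
def Connected (G : Multigraph) : Prop :=
  Nonempty G.V ∧ ∀ v w : G.V, Relation.ReflTransGen G.Joined v w

/-- Every vertex has exactly three half-edges (so a loop counts twice). -/
def Trivalent (G : Multigraph) : Prop :=
  ∀ v : G.V, Nat.card {x : G.E × Bool // G.ends x.1 x.2 = v} = 3

/-- The first Betti number of a connected graph. -/
def genus (G : Multigraph) : ℤ :=
  (Fintype.card G.E : ℤ) - Fintype.card G.V + 1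

/-- An isomorphism of graphs: compatible bijections of the vertices and of the half-edges, where
the half-edge `(e, b)` goes to `(edge e, b)` if `flip e = false` and to `(edge e, !b)` if
`flip e = true`. -/
@[ext]
structure Iso (G G' : Multigraph) where
  vert : G.V ≃ G'.V
  edge : G.E ≃ G'.E
  flip : G.E → Bool
  ends_eq : ∀ e b, G'.ends (edge e) (xor b (flip e)) = vert (G.ends e b)

/-- The identity. -/
def Iso.refl (G : Multigraph) : Iso G G where
  vert := Equiv.refl _
  edge := Equiv.refl _
  flip := fun _ => false
  ends_eq := by simp

/-- The inverse isomorphism. -/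
def Iso.symm {G G' : Multigraph} (φ : Iso G G') : Iso G' G where
  vert := φ.vert.symm
  edge := φ.edge.symm
  flip := fun e => φ.flip (φ.edge.symm e)
  ends_eq := fun e b => by
    rw [Equiv.eq_symm_apply, ← φ.ends_eq]
    simp

/-- The composition of isomorphisms. -/
def Iso.trans {G G' G'' : Multigraph} (φ : Iso G G') (ψ : Iso G' G'') : Iso G G'' where
  vert := φ.vert.trans ψ.vert
  edge := φ.edge.trans ψ.edge
  flip := fun e => xor (φ.flip e) (ψ.flip (φ.edge e))
  ends_eq := fun e b => by
    have h := ψ.ends_eq (φ.edge e) (xor b (φ.flip e))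
    rw [φ.ends_eq] at h
    simpa [Bool.xor_assoc] using h

end Multigraph

/-! ### Tropical curves and tropical covers -/

/-- A tropical curve: a connected, finite, trivalent metric graph. The edge `e` is the segment
`[0, length e]`, the end `0` being glued to `ends e false` and `length e` to `ends e true`. -/
structure TropicalCurve : Type 1 extends Multigraph where
  connected : toMultigraph.Connected
  trivalent : toMultigraph.Trivalent
  length : E → ℝ
  length_pos : ∀ e, 0 < length e

/-- The coordinate on the edge `φ e` of the image of the point with coordinate `t` on `e`, under
an isometry `φ`; here `len` is the length of `e`. -/
def flipCoord (flip : Bool) (len t : ℝ) : ℝ := if flip then len - t else t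

/-- An isometry of metric graphs: an isomorphism of the underlying (trivalent) graphs that
preserves the lengths; it maps each edge linearly. -/
@[ext]
structure CurveIso (C C' : TropicalCurve) extends
    Multigraph.Iso C.toMultigraph C'.toMultigraph where
  length_eq : ∀ e, C'.length (edge e) = C.length e

/-- The tropical elliptic curve of length `ℓ` is the circle `AddCircle ℓ = ℝ / ℓℤ`.

A map from a metric graph to it that is continuous and integer affine on each edge is given by the
images `vmap` of the vertices and the integers `slope e`, the slope on the edge `e` in the
direction from `ends e false` to `ends e true`; it is well defined and continuous by
`continuous_eq`. A tropical cover is such a map that is non-constant and balanced. -/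
structure PreCover (ℓ : ℝ) : Type 1 where
  C : TropicalCurve
  vmap : C.V → AddCircle ℓ
  slope : C.E → ℤ
  continuous_eq : ∀ e, vmap (C.ends e true) =
    vmap (C.ends e false) + ((slope e * C.length e : ℝ) : AddCircle ℓ)

namespace PreCover

variable {ℓ : ℝ}

/-- The image of the point with coordinate `t ∈ [0, length e]` of the edge `e`. -/
def edgeMap (π : PreCover ℓ) (e : π.C.E) (t : ℝ) : AddCircle ℓ :=
  π.vmap (π.C.ends e false) + ((π.slope e * t : ℝ) : AddCircle ℓ)

/-- The weight of an edge, i.e. the absolute value of the slope. -/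
def weight (π : PreCover ℓ) (e : π.C.E) : ℕ := (π.slope e).natAbs

/-- The slope along the ray that leaves the vertex `ends e b` through the half-edge `(e, b)`. The
ray maps to the right of the image of the vertex if this is positive, to the left if it is
negative. -/
def raySlope (π : PreCover ℓ) (e : π.C.E) (b : Bool) : ℤ :=
  if b then -π.slope e else π.slope e

open Classical in
/-- The balancing condition: at every vertex the weights of the rays that map to the left add up
to the same number as the weights of the rays that map to the right. -/
def Balanced (π : PreCover ℓ) : Prop :=
  ∀ v : π.C.V,
    ∑ x : π.C.E × Bool with π.C.ends x.1 x.2 = v ∧ π.raySlope x.1 x.2 < 0, π.weight x.1 =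
    ∑ x : π.C.E × Bool with π.C.ends x.1 x.2 = v ∧ 0 < π.raySlope x.1 x.2, π.weight x.1

/-- The map is not constant (the source being connected, not constant on some edge). -/
def NonConstant (π : PreCover ℓ) : Prop := ∃ e, π.slope e ≠ 0

/-- The weighted number of preimages of every point that is not the image of a vertex is `d`. -/
def HasDegree (π : PreCover ℓ) (d : ℕ) : Prop :=
  ∀ x : AddCircle ℓ, (∀ v, π.vmap v ≠ x) →
    ∑ e, Set.ncard {t : ℝ | t ∈ Set.Ioo 0 (π.C.length e) ∧ π.edgeMap e t = x} * π.weight e = d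

end PreCover

/-- A tropical cover of the tropical elliptic curve of length `ℓ`. -/
structure TropicalCover (ℓ : ℝ) : Type 1 extends PreCover ℓ where
  nonConstant : toPreCover.NonConstant
  balanced : toPreCover.Balanced

namespace TropicalCover

variable {ℓ : ℝ}

/-- An isomorphism of covers: an isometry `φ` of the source curves with `π' ∘ φ = π`. -/
@[ext]
structure Iso (π π' : TropicalCover ℓ) extends CurveIso π.C π'.C where
  map_eq : ∀ e, ∀ t ∈ Set.Icc 0 (π.C.length e),
    π'.edgeMap (edge e) (flipCoord (flip e) (π.C.length e) t) = π.edgeMap e t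

/-- The identity. -/
def Iso.refl (π : TropicalCover ℓ) : Iso π π where
  toIso := Multigraph.Iso.refl _
  length_eq := fun _ => rfl
  map_eq := fun _ _ _ => rfl

/-- The inverse isomorphism. -/
def Iso.symm {π π' : TropicalCover ℓ} (φ : Iso π π') : Iso π' π where
  toIso := φ.toIso.symm
  length_eq := fun e => by
    rw [← φ.length_eq]
    simp [Multigraph.Iso.symm]
  map_eq := fun e t ht => by
    obtain ⟨e, rfl⟩ := φ.edge.surjective e
    simp only [Multigraph.Iso.symm, Equiv.symm_apply_apply, φ.length_eq] at ht ⊢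
    have h : flipCoord (φ.flip e) (π.C.length e) t ∈ Set.Icc 0 (π.C.length e) := by
      unfold flipCoord
      split_ifs
      · exact ⟨by linarith [ht.2], by linarith [ht.1]⟩
      · exact ht
    rw [← φ.map_eq e _ h]
    congr 1
    unfold flipCoord
    split_ifs <;> ring

/-- The composition of isomorphisms. -/
def Iso.trans {π π' π'' : TropicalCover ℓ} (φ : Iso π π') (ψ : Iso π' π'') : Iso π π'' where
  toIso := φ.toIso.trans ψ.toIso
  length_eq := fun e => by
    simp [Multigraph.Iso.trans, ψ.length_eq, φ.length_eq]
  map_eq := fun e t ht => by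
    have h : flipCoord (φ.flip e) (π.C.length e) t ∈ Set.Icc 0 (π'.C.length (φ.edge e)) := by
      rw [φ.length_eq]
      unfold flipCoord
      split_ifs
      · exact ⟨by linarith [ht.2], by linarith [ht.1]⟩
      · exact ht
    rw [← φ.map_eq e t ht, ← ψ.map_eq _ _ h, φ.length_eq]
    simp only [Multigraph.Iso.trans, Equiv.trans_apply]
    congr 1
    unfold flipCoord
    cases φ.flip e <;> cases ψ.flip (φ.edge e) <;> simp

/-- The multiplicity `(∏ₑ wₑ) / |Aut π|`. -/
def mult (π : TropicalCover ℓ) : ℚ :=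
  (∏ e, (π.weight e : ℚ)) / Nat.card (Iso π π)

end TropicalCover

/-- The covers of degree `d` with source of genus `g` and with set of branch points (i.e. images
of the vertices) `{p 1, …, p (2g - 2)}`. -/
def Cover (ℓ : ℝ) (g : ℕ) (p : Fin (2 * g - 2) → AddCircle ℓ) (d : ℕ) : Type 1 :=
  {π : TropicalCover ℓ //
    π.C.genus = g ∧ π.HasDegree d ∧ Set.range π.vmap = Set.range p}

/-- Isomorphism of covers. -/
instance coverSetoid (ℓ : ℝ) (g : ℕ) (p : Fin (2 * g - 2) → AddCircle ℓ) (d : ℕ) :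
    Setoid (Cover ℓ g p d) where
  r π π' := Nonempty (TropicalCover.Iso π.1 π'.1)
  iseqv :=
    { refl := fun π => ⟨TropicalCover.Iso.refl π.1⟩
      symm := fun ⟨φ⟩ => ⟨φ.symm⟩
      trans := fun ⟨φ⟩ ⟨ψ⟩ => ⟨φ.trans ψ⟩ }

/-- The set of isomorphism classes of covers. -/
def CoverClass (ℓ : ℝ) (g : ℕ) (p : Fin (2 * g - 2) → AddCircle ℓ) (d : ℕ) : Type 1 :=
  Quotient (coverSetoid ℓ g p d)

/-- The tropical Hurwitz number: the sum of the multiplicities of one cover from each isomorphism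
class. -/
def tropicalHurwitz (ℓ : ℝ) (g : ℕ) (p : Fin (2 * g - 2) → AddCircle ℓ) (d : ℕ) : ℚ :=
  ∑ᶠ c : CoverClass ℓ g p d, (Quotient.out c).1.mult

/-! ### The propagator and Feynman integrals -/

/-- The Eisenstein series `E₂(q) = 1 - 24 ∑_{d ≥ 1} σ(d) q^d`. -/
def eisensteinE2 (q : ℂ) : ℂ :=
  1 - 24 * ∑' d : ℕ, (ArithmeticFunction.sigma 1 (d + 1) : ℂ) * q ^ (d + 1)

/-- The periods `1, τ`. -/
def periods (τ : UpperHalfPlane) : PeriodPair where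
  ω₁ := 1
  ω₂ := τ
  indep := by
    rw [LinearIndependent.pair_iff]
    intro a b h
    have him := congrArg Complex.im h
    have hb : b = 0 := by
      simpa [τ.im_ne_zero] using him
    subst hb
    have hre := congrArg Complex.re h
    exact ⟨by simpa using hre, rfl⟩

/-- The coordinate `q = exp (π i τ)`. -/
def nome (τ : UpperHalfPlane) : ℂ := Complex.exp (Real.pi * Complex.I * τ)

/-- The propagator `P(z, q) = ℘(z, q) / (4 π²) + E₂(q²) / 12`, where `q = exp (π i τ)` and `℘` is
the Weierstrass function of the lattice `ℤ + ℤτ`. At the poles of `℘`, `weierstrassP` takes the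
value of the finite part, which is `0`; this concerns only the edges of a graph that are loops,
where `P` is evaluated at `z = 0`. -/
def propagator (z : ℂ) (τ : UpperHalfPlane) : ℂ :=
  1 / (4 * (Real.pi : ℂ) ^ 2) * (periods τ).weierstrassP z + 1 / 12 * eisensteinE2 (nome τ ^ 2)

/-- A Feynman graph of genus `g`. -/
def FeynmanGraph (g : ℕ) : Type 1 :=
  {Γ : Multigraph // Γ.Connected ∧ Γ.Trivalent ∧ Γ.genus = g}

/-- Isomorphism of Feynman graphs. -/
instance feynmanSetoid (g : ℕ) : Setoid (FeynmanGraph g) where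
  r Γ Γ' := Nonempty (Multigraph.Iso Γ.1 Γ'.1)
  iseqv :=
    { refl := fun Γ => ⟨Multigraph.Iso.refl Γ.1⟩
      symm := fun ⟨φ⟩ => ⟨φ.symm⟩
      trans := fun ⟨φ⟩ ⟨ψ⟩ => ⟨φ.trans ψ⟩ }

/-- The set of isomorphism classes of Feynman graphs of genus `g`. -/
def FeynmanClass (g : ℕ) : Type 1 := Quotient (feynmanSetoid g)

/-- A total order of the vertices, given by the position of each vertex. -/
abbrev VertexOrder (Γ : Multigraph) : Type := Γ.V ≃ Fin (Fintype.card Γ.V)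

/-- `i y v`, for `v` a vertex, are admissible starting points of the integration paths for the
order `Ω`: the `y v` are ordered as `Ω` says, and they are small, in the sense that their
differences are smaller than the imaginary part of `τ`. -/
def Admissible {Γ : Multigraph} (Ω : VertexOrder Γ) (τ : UpperHalfPlane) (y : Γ.V → ℝ) : Prop :=
  (∀ v w, Ω v < Ω w → y v < y w) ∧ ∀ v w, |y v - y w| < τ.im

/-- The integral of `∏ₑ (-P(z_v - z_w, q))` (where `v`, `w` are the ends of `e`) over the paths
`z_v = i y_v + t_v`, `t_v ∈ [0, 1]`. -/
def feynmanIntegral (Γ : Multigraph) (y : Γ.V → ℝ) (τ : UpperHalfPlane) : ℂ :=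
  ∫ t in Set.Icc (0 : Γ.V → ℝ) 1,
    ∏ e, -propagator ((Complex.I * y (Γ.ends e false) + t (Γ.ends e false)) -
      (Complex.I * y (Γ.ends e true) + t (Γ.ends e true))) τ

open Classical in
/-- The sum of the integrals over all orders `Ω` of the vertices, with starting points `y Ω`. -/
def feynmanSum (Γ : Multigraph) (y : VertexOrder Γ → Γ.V → ℝ) (τ : UpperHalfPlane) : ℂ :=
  ∑ Ω : VertexOrder Γ, feynmanIntegral Γ (y Ω) τ

end TropMirror

end

/-! Both sides count the same objects: a Feynman graph with an order of its vertices and a flow,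
that is, slopes and winding numbers on the edges, the slopes balanced at every vertex, such that
every edge runs in the direction of its slope (`IsFlow`). A flow is weighted by the product of its
absolute slopes and by `q ^ (2 * d)`, where `d` is the sum of slope times winding number.

Integral side: Lipschitz's formula, applied to each horizontal row of the lattice sum for `℘`,
expands `-P` into a double series over momentum and winding number; the Eisenstein series cancels
the constants that `℘` subtracts (`hasSum_fourierTerm`). After the product over the edges is
expanded, integration over the real parts keeps exactly the balanced assignments
(`hasSum_feynmanIntegral`). A trivalent graph with a loop carries no flow
(`ends_ne_of_excess_eq_zero`), so its integrals vanish. Being a flow depends only on the order of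
the vertices (`isFlow_congr`), so the heights `y` may be replaced by lifts of the branch points to
`[0, ℓ)`.

Tropical side: a flow forces the edge lengths and thus gives a cover, whose degree is its number of
turns (`PreCover.hasDegree_iff`). Conversely, every graph isomorphism from `Γ` to the source of a
cover comes from exactly one marking of `Γ` and one isomorphism of covers (`bijective_graphIso`).
Hence the markings that give a cover `π`, times `|Aut π|`, number the isomorphisms from `Γ` to its
source (`card_fiber_mul_card_iso`); division by `|Aut Γ|` and summation over `Γ` leave each cover
with its multiplicity (`sum_card_iso_ref_div`). -/

noncomputable section

namespace TropMirror

section Analysis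

open Complex

/-! ### The Fourier expansion of the propagator -/

/-- The function `exp (2 π i x)`. -/
def expTwoPi (x : ℂ) : ℂ := exp (2 * Real.pi * I * x)

lemma expTwoPi_add (x y : ℂ) : expTwoPi (x + y) = expTwoPi x * expTwoPi y := by
  simp [expTwoPi, mul_add, exp_add]

lemma expTwoPi_zero : expTwoPi 0 = 1 := by simp [expTwoPi]

lemma expTwoPi_intCast (n : ℤ) : expTwoPi n = 1 := by
  rw [expTwoPi, mul_comm]
  exact exp_int_mul_two_pi_mul_I n

lemma expTwoPi_ne_zero (x : ℂ) : expTwoPi x ≠ 0 := exp_ne_zero _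

lemma expTwoPi_int_mul (n : ℤ) (x : ℂ) : expTwoPi (n * x) = expTwoPi x ^ n := by
  rw [expTwoPi, expTwoPi, ← exp_int_mul]
  ring_nf

lemma expTwoPi_nat_mul (n : ℕ) (x : ℂ) : expTwoPi (n * x) = expTwoPi x ^ n := by
  simpa using expTwoPi_int_mul n x

lemma expTwoPi_sum {ι : Type*} (s : Finset ι) (f : ι → ℂ) :
    expTwoPi (∑ i ∈ s, f i) = ∏ i ∈ s, expTwoPi (f i) := by
  simp [expTwoPi, Finset.mul_sum, exp_sum]

lemma norm_expTwoPi (x : ℂ) : ‖expTwoPi x‖ = Real.exp (-(2 * Real.pi * x.im)) := by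
  simp [expTwoPi, norm_exp]

/-- The sum of `1 / (x + j) ^ 2` over the integers `j`, where a term with `x + j = 0` is omitted. -/
def rowSum (x : ℂ) : ℂ := ∑' j : ℤ, 1 / (x + j) ^ 2

lemma summable_rowSum (x : ℂ) : Summable fun j : ℤ => 1 / (x + j) ^ 2 := by
  refine (EisensteinSeries.linear_right_summable x 1 (k := 2) le_rfl).congr fun j => ?_
  simp

lemma rowSum_neg (x : ℂ) : rowSum (-x) = rowSum x := by
  rw [rowSum, rowSum, ← (Equiv.neg ℤ).tsum_eq]
  refine tsum_congr fun j => ?_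
  simp only [Equiv.neg_apply, Int.cast_neg]
  congr 1
  ring

/-- Lipschitz's formula for exponent two; the constant is `(-2πi)² = -4π²`. -/
lemma hasSum_rowSum_of_pos {x : ℂ} (hx : 0 < x.im) :
    HasSum (fun n : ℕ => (n : ℂ) * expTwoPi (n * x)) (-(1 / (4 * (Real.pi : ℂ) ^ 2)) * rowSum x) := by
  have h := EisensteinSeries.qExpansion_identity le_rfl ⟨x, hx⟩
  have hs : Summable fun n : ℕ => (n : ℂ) ^ 1 * expTwoPi x ^ n := by
    refine Summable.of_norm (summable_norm_pow_mul_geometric_of_norm_lt_one 1 ?_)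
    rw [norm_expTwoPi, Real.exp_lt_one_iff]
    have := Real.pi_pos
    nlinarith [mul_pos this hx]
  have h' : rowSum x = (-2 * Real.pi * I) ^ 2 * ∑' n : ℕ, (n : ℂ) ^ 1 * expTwoPi x ^ n := by
    rw [rowSum]
    simpa [expTwoPi] using h
  rw [h']
  convert hs.hasSum using 1
  · ext n
    rw [expTwoPi_nat_mul, pow_one]
  · have : (Real.pi : ℂ) ≠ 0 := by exact_mod_cast Real.pi_ne_zero
    rw [mul_pow, mul_pow, I_sq]
    field_simp
    ring

/-- In the lower half-plane evenness of `rowSum` reduces to the upper one. The condition selects the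
exponents that decay; their sign later becomes the direction of an edge. -/
lemma hasSum_rowSum {x : ℂ} (hx : x.im ≠ 0) :
    HasSum (fun s : ℤ => if 0 < s * x.im then (s.natAbs : ℂ) * expTwoPi (s * x) else 0)
      (-(1 / (4 * (Real.pi : ℂ) ^ 2)) * rowSum x) := by
  have key : ∀ x : ℂ, 0 < x.im →
      HasSum (fun s : ℤ => if 0 < s * x.im then (s.natAbs : ℂ) * expTwoPi (s * x) else 0)
      (-(1 / (4 * (Real.pi : ℂ) ^ 2)) * rowSum x) := by
    intro x hx
    rw [← (Nat.cast_injective (R := ℤ)).hasSum_iff]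
    · convert hasSum_rowSum_of_pos hx using 1
      ext n
      rcases Nat.eq_zero_or_pos n with rfl | hn
      · simp
      · have : 0 < (n : ℝ) * x.im := by positivity
        simp [this]
    · intro s hs
      rw [if_neg]
      intro h
      have : (0 : ℝ) < s := pos_of_mul_pos_left h hx.le
      exact hs ⟨s.toNat, Int.toNat_of_nonneg (by exact_mod_cast this.le)⟩
  rcases hx.lt_or_gt with h | h
  · have := key (-x) (by simpa using h)
    rw [rowSum_neg, ← (Equiv.neg ℤ).hasSum_iff] at this
    convert this using 1
    ext s
    simp
  · exact key x h

/-- The term of the Fourier expansion of the propagator given by the momentum `a.1` and the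
winding number `a.2`. -/
def fourierTerm (z τ : ℂ) (a : ℤ × ℤ) : ℂ :=
  if 0 < a.1 * (z.im + a.2 * τ.im) then (a.1.natAbs : ℂ) * expTwoPi (a.1 * (z + a.2 * τ)) else 0

lemma summable_natAbs_mul_pow {r : ℝ} (hr : 0 ≤ r) (hr' : r < 1) (k : ℕ) :
    Summable fun s : ℤ => (s.natAbs : ℝ) ^ k * r ^ s.natAbs := by
  have h := summable_norm_pow_mul_geometric_of_norm_lt_one (R := ℝ) k (r := r)
    (by rwa [Real.norm_of_nonneg hr])
  have h' : Summable fun n : ℕ => (n : ℝ) ^ k * r ^ n :=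
    h.congr fun n => Real.norm_of_nonneg (by positivity)
  exact .of_nat_of_neg (by simpa using h') (by simpa using h')

/-- As `|s| ≥ 1` wherever the term is nonzero, `|s| (|n| + 1) ≥ |s| + |n|`, so the double series is
dominated by a product of two one-variable series. -/
lemma norm_fourierTerm_le {z τ : ℂ} {δ : ℝ} (hδ : 0 < δ)
    (h : ∀ n : ℤ, δ * (n.natAbs + 1) ≤ |z.im + n * τ.im|) (a : ℤ × ℤ) :
    ‖fourierTerm z τ a‖ ≤ (a.1.natAbs : ℝ) ^ 1 * Real.exp (-(2 * Real.pi * δ)) ^ a.1.natAbs *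
      ((a.2.natAbs : ℝ) ^ 0 * Real.exp (-(2 * Real.pi * δ)) ^ a.2.natAbs) := by
  obtain ⟨s, n⟩ := a
  unfold fourierTerm
  split_ifs with hs
  · simp only at hs ⊢
    rw [norm_mul, norm_expTwoPi, pow_one, pow_zero, one_mul, mul_assoc (s.natAbs : ℝ), ← pow_add,
      ← Real.exp_nat_mul, Complex.norm_natCast]
    gcongr
    have him : ((s : ℂ) * (z + n * τ)).im = s * (z.im + n * τ.im) := by
      simp
    rw [him, ← abs_of_pos hs, abs_mul]
    have hs1 : (1 : ℝ) ≤ |(s : ℝ)| := by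
      have : s ≠ 0 := by
        rintro rfl
        simp at hs
      exact_mod_cast Int.one_le_abs this
    have hn := h n
    have hcast : (s.natAbs : ℝ) = |(s : ℝ)| := by
      rw [Nat.cast_natAbs, Int.cast_abs]
    push_cast
    rw [hcast]
    have h1 : δ * (|(s : ℝ)| + n.natAbs) ≤ |(s : ℝ)| * |z.im + n * τ.im| := by
      calc δ * (|(s : ℝ)| + n.natAbs) ≤ δ * (|(s : ℝ)| * (n.natAbs + 1)) := by
            gcongr
            nlinarith [(Nat.cast_nonneg n.natAbs : (0 : ℝ) ≤ _)]
        _ = |(s : ℝ)| * (δ * (n.natAbs + 1)) := by ring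
        _ ≤ _ := by gcongr
    have := Real.pi_pos
    nlinarith [mul_le_mul_of_nonneg_left h1 (by positivity : 0 ≤ 2 * Real.pi)]
  · rw [norm_zero]
    positivity

lemma exists_row_distance {θ η : ℝ} (hθ : θ ≠ 0) (h : |θ| < η) :
    ∃ δ > 0, ∀ n : ℤ, δ * (n.natAbs + 1) ≤ |θ + n * η| := by
  have h0 : 0 < |θ| := abs_pos.2 hθ
  have hmin : 0 < min |θ| (η - |θ|) := lt_min h0 (by linarith)
  -- Half of the minimum suffices: for `n ≠ 0` the distance is at least `|n| (η - |θ|)`, and `|n| +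
  -- 1 ≤ 2 |n|`.
  refine ⟨min |θ| (η - |θ|) / 2, by positivity, fun n => ?_⟩
  rcases eq_or_ne n 0 with rfl | hn
  · simp only [Int.natAbs_zero, Nat.cast_zero, zero_add, mul_one, Int.cast_zero, zero_mul, add_zero]
    linarith [min_le_left |θ| (η - |θ|)]
  · have h1 : (1 : ℝ) ≤ |(n : ℝ)| := by exact_mod_cast Int.one_le_abs hn
    have hc : (n.natAbs : ℝ) = |(n : ℝ)| := by rw [Nat.cast_natAbs, Int.cast_abs]
    rw [hc]
    have h2 : |(n : ℝ)| * η - |θ| ≤ |θ + n * η| := by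
      have := abs_sub_abs_le_abs_sub (n * η) (-θ)
      rw [abs_mul, abs_neg, abs_of_pos (h0.trans h), sub_neg_eq_add, add_comm] at this
      linarith
    nlinarith [min_le_right |θ| (η - |θ|)]

lemma summable_norm_fourierTerm {z τ : ℂ} (hz : z.im ≠ 0) (h : |z.im| < τ.im) :
    Summable fun a => ‖fourierTerm z τ a‖ := by
  obtain ⟨δ, hδ, hb⟩ := exists_row_distance hz h
  have hr : Real.exp (-(2 * Real.pi * δ)) < 1 := by
    rw [Real.exp_lt_one_iff]
    have := Real.pi_pos
    nlinarith [mul_pos this hδ]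
  refine Summable.of_nonneg_of_le (fun _ => norm_nonneg _) (norm_fourierTerm_le hδ hb) ?_
  exact (summable_natAbs_mul_pow (Real.exp_pos _).le hr 1).mul_of_nonneg
    (summable_natAbs_mul_pow (Real.exp_pos _).le hr 0) (fun _ => by positivity)
    (fun _ => by positivity)

/-- This is `2 ζ(2)`; the term `j = 0` is `1 / 0 = 0`. -/
lemma rowSum_zero : rowSum 0 = (Real.pi : ℂ) ^ 2 / 3 := by
  have h := tsum_int_eq_zero_add_two_mul_tsum_pnat (f := fun j : ℤ => 1 / ((0 : ℂ) + j) ^ 2)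
    (fun j => by simp) (summable_rowSum 0)
  rw [rowSum, h]
  have h2 := hasSum_zeta_two
  have h3 : HasSum (fun n : ℕ => 1 / (n : ℂ) ^ 2) ((Real.pi : ℂ) ^ 2 / 6) := by
    simpa using Complex.hasSum_ofReal.2 h2
  have h4 := tsum_zero_pnat_eq_tsum_nat h3.summable
  rw [h3.tsum_eq] at h4
  simp at h4 ⊢
  rw [h4]
  ring

lemma nome_sq (τ : UpperHalfPlane) : nome τ ^ 2 = expTwoPi τ := by
  rw [nome, expTwoPi, ← exp_nat_mul]
  ring_nf

/-- Lipschitz's formula in each row gives a Lambert series, whose terms with equal product `n * c`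
collect into divisor sums. -/
lemma tsum_rowSum_pnat (τ : UpperHalfPlane) :
    ∑' n : ℕ+, rowSum (n * τ) = -(4 * (Real.pi : ℂ) ^ 2) *
      ∑' d : ℕ, (ArithmeticFunction.sigma 1 (d + 1) : ℂ) * (nome τ ^ 2) ^ (d + 1) := by
  have hr : ‖expTwoPi τ‖ < 1 := by
    rw [norm_expTwoPi, Real.exp_lt_one_iff]
    have := mul_pos Real.pi_pos τ.im_pos
    simp only [UpperHalfPlane.coe_im]
    nlinarith
  rw [nome_sq, ← tsum_pnat_eq_tsum_succ
    (f := fun d => (ArithmeticFunction.sigma 1 d : ℂ) * expTwoPi τ ^ d),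
    ← tsum_prod_pow_eq_tsum_sigma 1 hr, ← tsum_mul_left]
  refine tsum_congr fun n => ?_
  have him : 0 < ((n : ℂ) * (τ : ℂ)).im := by
    have : (0 : ℝ) < n := by exact_mod_cast n.pos
    have := mul_pos this τ.im_pos
    simpa using this
  have h := hasSum_rowSum_of_pos him
  have h1 := tsum_zero_pnat_eq_tsum_nat h.summable
  rw [h.tsum_eq] at h1
  have h2 : ∑' c : ℕ+, (c : ℂ) ^ 1 * expTwoPi τ ^ (n * c : ℕ) =
      ∑' c : ℕ+, (c : ℂ) * expTwoPi (c * (n * τ)) := by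
    refine tsum_congr fun c => ?_
    have : ((c : ℕ) : ℂ) * ((n : ℕ) * (τ : ℂ)) = ((n * c : ℕ) : ℂ) * τ := by
      push_cast
      ring
    rw [pow_one, this, expTwoPi_nat_mul]
  have hπ : (Real.pi : ℂ) ≠ 0 := by exact_mod_cast Real.pi_ne_zero
  rw [h2]
  simp only [Nat.cast_zero, zero_mul, zero_add] at h1
  rw [h1]
  field_simp

/-- The lattice sum converges unconditionally, so it may be grouped by the coefficient of `τ`.
Within a row the two parts converge separately. -/
lemma hasSum_weierstrassP_rows (z : ℂ) (τ : UpperHalfPlane) :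
    HasSum (fun n : ℤ => rowSum (z + n * τ) - rowSum (n * τ)) ((periods τ).weierstrassP z) := by
  -- Evaluation at `-z` turns the differences `z - ω` of the lattice sum into the sums `z + ω` of
  -- `rowSum`.
  have h := (periods τ).hasSum_weierstrassP (-z)
  rw [PeriodPair.weierstrassP_neg,
    ← ((Equiv.prodComm ℤ ℤ).trans (periods τ).latticeEquivProd.symm.toEquiv).hasSum_iff] at h
  refine h.prod_fiberwise fun n => ?_
  have h1 := (summable_rowSum (z + n * τ)).hasSum.sub (summable_rowSum (n * τ)).hasSum
  refine h1.congr_fun fun j => ?_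
  have hl := (periods τ).latticeEquiv_symm_apply (j, n)
  simp only [Function.comp_apply, Equiv.trans_apply, Equiv.prodComm_apply, Prod.swap_prod_mk,
    LinearEquiv.coe_toEquiv]
  rw [hl]
  simp only [periods]
  congr 2 <;> ring

/-- The Fourier series sums the rows through `z`, whereas `℘` also subtracts the rows through `0`.
The latter add up to `π² / 3` times `E₂(q²)`, which is what the second summand of the propagator
restores. -/
theorem hasSum_fourierTerm {z : ℂ} {τ : UpperHalfPlane} (hz : z.im ≠ 0) (h : |z.im| < τ.im) :
    HasSum (fourierTerm z τ) (-propagator z τ) := by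
  have hπ : (Real.pi : ℂ) ≠ 0 := by exact_mod_cast Real.pi_ne_zero
  have hne : ∀ n : ℤ, (z + n * τ).im ≠ 0 := by
    obtain ⟨δ, hδ, hb⟩ := exists_row_distance hz h
    intro n h0
    have hn := hb n
    have : z.im + n * τ.im = 0 := by simpa using h0
    rw [this, abs_zero] at hn
    have : 0 < δ * (n.natAbs + 1) := by positivity
    linarith
  have hs : Summable (fourierTerm z τ) := (summable_norm_fourierTerm hz h).of_norm
  have h1 : HasSum (fun n : ℤ => -(1 / (4 * (Real.pi : ℂ) ^ 2)) * rowSum (z + n * τ))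
      (∑' a, fourierTerm z τ a) := by
    have := (Equiv.prodComm ℤ ℤ).hasSum_iff.2 hs.hasSum
    refine this.prod_fiberwise fun n => ?_
    convert hasSum_rowSum (hne n) using 1
    ext s
    simp [fourierTerm]
  have h2 := (hasSum_weierstrassP_rows z τ).mul_left (-(1 / (4 * (Real.pi : ℂ) ^ 2)))
  have h3 := (h1.sub h2).mul_left (-(4 * (Real.pi : ℂ) ^ 2))
  -- The series of constant rows converges as the difference of two convergent series.
  have h4 : Summable fun n : ℤ => rowSum (n * τ) := by
    refine h3.summable.congr fun n => ?_
    field_simp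
    ring
  have h5 := tsum_int_eq_zero_add_two_mul_tsum_pnat (f := fun n : ℤ => rowSum (n * τ))
    (fun n => by
      change rowSum ((-n : ℤ) * τ) = rowSum (n * τ)
      rw [← rowSum_neg]
      simp) h4
  have h6 := h3.tsum_eq
  have h7 : ∑' n : ℤ, (-(4 * (Real.pi : ℂ) ^ 2)) * (-(1 / (4 * (Real.pi : ℂ) ^ 2)) *
      rowSum (z + n * τ) - -(1 / (4 * (Real.pi : ℂ) ^ 2)) * (rowSum (z + n * τ) - rowSum (n * τ))) =
      ∑' n : ℤ, rowSum (n * τ) := by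
    refine tsum_congr fun n => ?_
    field_simp
    ring
  rw [h7, h5] at h6
  convert hs.hasSum using 1
  simp only [Int.cast_zero, zero_mul, rowSum_zero, Int.cast_natCast, tsum_rowSum_pnat, nsmul_eq_mul]
    at h6
  rw [propagator, eisensteinE2]
  set S := ∑' d : ℕ, (ArithmeticFunction.sigma 1 (d + 1) : ℂ) * (nome τ ^ 2) ^ (d + 1)
  set T := ∑' a, fourierTerm z τ a
  have h8 : T = -(1 / (4 * (Real.pi : ℂ) ^ 2)) * (periods τ).weierstrassP z -
      (1 / (4 * (Real.pi : ℂ) ^ 2)) * ((Real.pi : ℂ) ^ 2 / 3 + (2 : ℕ) * (-(4 * (Real.pi : ℂ) ^ 2) * S)) := by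
    rw [h6]
    field_simp
    ring
  rw [h8]
  field_simp
  push_cast
  ring

/-! ### Flows on graphs -/

namespace Multigraph

variable (G : Multigraph)

/-- The flow that leaves a vertex through a half-edge, if `s e` flows through the edge `e` in its
reference direction. -/
def halfFlow (s : G.E → ℤ) (x : G.E × Bool) : ℤ := if x.2 then -s x.1 else s x.1

open Classical in
/-- The total flow that leaves a vertex. -/
def excess (s : G.E → ℤ) (v : G.V) : ℤ :=
  ∑ x : G.E × Bool with G.ends x.1 x.2 = v, G.halfFlow s x

/-- A balanced assignment of slopes `(a e).1` and winding numbers `(a e).2` to the edges, such that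
every edge runs in the direction of its slope if the vertices are placed at `P` on a circle of
length `ℓ`. -/
def IsFlow (P : G.V → ℝ) (ℓ : ℝ) (a : G.E → ℤ × ℤ) : Prop :=
  (∀ v, G.excess (fun e => (a e).1) v = 0) ∧
    ∀ e, 0 < (a e).1 * (P (G.ends e true) - P (G.ends e false) + (a e).2 * ℓ)

/-- The weighted number of turns around the circle. -/
def turns (a : G.E → ℤ × ℤ) : ℤ := ∑ e, (a e).1 * (a e).2

variable {G}

/-- Summation by parts: both sides regroup the same sum over half-edges. For a balanced `s` the left
side vanishes; this is used for positions, for integration variables and for `passing`. -/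
lemma sum_mul_sub_eq {R : Type*} [CommRing R] (s : G.E → ℤ) (f : G.V → R) :
    ∑ e, (s e : R) * (f (G.ends e true) - f (G.ends e false)) =
      -∑ v, (G.excess s v : R) * f v := by
  classical
  have h : ∑ v, (G.excess s v : R) * f v =
      ∑ x : G.E × Bool, (G.halfFlow s x : R) * f (G.ends x.1 x.2) := by
    rw [← Finset.sum_fiberwise (s := Finset.univ) (g := fun x : G.E × Bool => G.ends x.1 x.2)]
    refine Finset.sum_congr rfl fun v _ => ?_
    rw [excess, Int.cast_sum, Finset.sum_mul]
    refine Finset.sum_congr (by congr) fun x hx => ?_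
    rw [(Finset.mem_filter.1 hx).2]
  rw [h, Fintype.sum_prod_type, ← Finset.sum_neg_distrib]
  refine Finset.sum_congr rfl fun e _ => ?_
  simp [halfFlow]
  ring

/-- The two halves of a loop cancel in the balance at its vertex, so the third half-edge carries
nothing. By `h` its edge is a loop too, and its other half would be a fourth half-edge there. -/
lemma ends_ne_of_excess_eq_zero (hG : G.Trivalent) {s : G.E → ℤ} (hs : ∀ v, G.excess s v = 0)
    (h : ∀ e, G.ends e false ≠ G.ends e true → s e ≠ 0) (e : G.E) :
    G.ends e false ≠ G.ends e true := by
  classical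
  intro he
  set v := G.ends e true with hv
  have hcard := hG v
  rw [Nat.card_eq_fintype_card, Fintype.card_subtype] at hcard
  set F : Finset (G.E × Bool) := Finset.univ.filter fun x => G.ends x.1 x.2 = v with hF
  have h1 : (e, false) ∈ F := by simp [hF, he]
  have h2 : (e, true) ∈ F.erase (e, false) := by simp [hF, hv]
  have hc : ((F.erase (e, false)).erase (e, true)).card = 1 := by
    rw [Finset.card_erase_of_mem h2, Finset.card_erase_of_mem h1, hcard]
  obtain ⟨x, hx⟩ := Finset.card_eq_one.1 hc
  have hxm : x ∈ (F.erase (e, false)).erase (e, true) := by simp [hx]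
  have hsum : G.excess s v = G.halfFlow s x := by
    have : G.excess s v = ∑ x ∈ F, G.halfFlow s x := by
      rw [excess]
    rw [this, ← Finset.add_sum_erase F _ h1, ← Finset.add_sum_erase _ _ h2, hx]
    simp [halfFlow]
  rw [hs v] at hsum
  obtain ⟨e', b⟩ := x
  have hs0 : s e' = 0 := by
    cases b <;> simpa [halfFlow] using hsum.symm
  have hloop : G.ends e' false = G.ends e' true := by
    by_contra hne
    exact h e' hne hs0
  have hm : (e', !b) ∈ (F.erase (e, false)).erase (e, true) := by
    simp only [Finset.mem_erase, ne_eq, Prod.mk.injEq, hF, Finset.mem_filter, Finset.mem_univ,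
      true_and] at hxm ⊢
    cases b <;> simp_all
  rw [hx] at hm
  cases b <;> simp at hm

/-- Whether an assignment is a flow depends only on the order of the vertices. -/
lemma isFlow_congr {P P' : G.V → ℝ} {ℓ ℓ' : ℝ} (h : ∀ v w, |P v - P w| < ℓ)
    (h' : ∀ v w, |P' v - P' w| < ℓ') (hPP' : ∀ v w, P v < P w ↔ P' v < P' w)
    (a : G.E → ℤ × ℤ) : G.IsFlow P ℓ a ↔ G.IsFlow P' ℓ' a := by
  have key : ∀ {P P' : G.V → ℝ} {ℓ ℓ' : ℝ} (h : ∀ v w, |P v - P w| < ℓ)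
      (h' : ∀ v w, |P' v - P' w| < ℓ') (hPP' : ∀ v w, P v < P w ↔ P' v < P' w),
      G.IsFlow P ℓ a → G.IsFlow P' ℓ' a := by
    intro P P' ℓ ℓ' h h' hPP' ha
    refine ⟨ha.1, fun e => ?_⟩
    have he := ha.2 e
    set v := G.ends e true
    set w := G.ends e false
    generalize (a e).1 = s at he ⊢
    generalize (a e).2 = n at he ⊢
    have h1 := abs_lt.1 (h v w)
    have h2 := abs_lt.1 (h' v w)
    have hℓ : 0 < ℓ := by linarith
    have hℓ' : 0 < ℓ' := by linarith
    have h3 := hPP' v w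
    have h4 := hPP' w v
    -- Differences of positions are less than one turn, so a nonzero winding number alone fixes the
    -- sign of the displacement; for `n = 0` the order does.
    rcases lt_trichotomy n 0 with hn | rfl | hn
    · have hn1 : (n : ℝ) ≤ -1 := by exact_mod_cast Int.le_sub_one_of_lt hn
      have e1 : P v - P w + n * ℓ < 0 := by nlinarith
      have e2 : P' v - P' w + n * ℓ' < 0 := by nlinarith
      exact mul_pos_of_neg_of_neg (neg_of_mul_pos_left he e1.le) e2
    · simp only [Int.cast_zero, zero_mul, add_zero] at he ⊢
      rcases lt_trichotomy (P v) (P w) with hlt | heq | hlt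
      · exact mul_pos_of_neg_of_neg (neg_of_mul_pos_left he (by linarith))
          (by linarith [h3.1 hlt])
      · simp [heq] at he
      · exact mul_pos (pos_of_mul_pos_left he (by linarith)) (by linarith [h4.1 hlt])
    · have hn1 : (1 : ℝ) ≤ n := by exact_mod_cast hn
      have e1 : 0 < P v - P w + n * ℓ := by nlinarith
      have e2 : 0 < P' v - P' w + n * ℓ' := by nlinarith
      exact mul_pos (pos_of_mul_pos_left he e1.le) e2
  exact ⟨key h h' hPP', key h' h fun v w => (hPP' v w).symm⟩

/-- The positions drop out by balancing. Since every summand on the left is positive, so is the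
number of turns. -/
lemma IsFlow.sum_mul_eq {P : G.V → ℝ} {ℓ : ℝ} {a : G.E → ℤ × ℤ} (ha : G.IsFlow P ℓ a) :
    ∑ e, ((a e).1 : ℝ) * (P (G.ends e true) - P (G.ends e false) + (a e).2 * ℓ) =
      G.turns a * ℓ := by
  have h := sum_mul_sub_eq (fun e => (a e).1) P
  simp only [ha.1, Int.cast_zero, zero_mul, Finset.sum_const_zero, neg_zero] at h
  simp only [mul_add, Finset.sum_add_distrib, h, zero_add, turns, Int.cast_sum, Int.cast_mul,
    Finset.sum_mul, mul_assoc]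

lemma IsFlow.turns_pos [Nonempty G.E] {P : G.V → ℝ} {ℓ : ℝ} (hℓ : 0 < ℓ) {a : G.E → ℤ × ℤ}
    (ha : G.IsFlow P ℓ a) : 0 < G.turns a := by
  have h : 0 < (G.turns a : ℝ) * ℓ := by
    rw [← ha.sum_mul_eq]
    exact Finset.sum_pos (fun e _ => ha.2 e) Finset.univ_nonempty
  exact_mod_cast pos_of_mul_pos_left h hℓ.le

lemma IsFlow.fst_ne_zero {P : G.V → ℝ} {ℓ : ℝ} {a : G.E → ℤ × ℤ} (ha : G.IsFlow P ℓ a) (e : G.E) :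
    (a e).1 ≠ 0 := by
  intro h
  have := ha.2 e
  simp [h] at this

end Multigraph

/-! ### Finite products of series -/

/-- Products of absolutely convergent series with index set `A`, one for each `i : ι`, can be
expanded. -/
def ProdExpands (ι A : Type) [Fintype ι] : Prop :=
  ∀ f : ι → A → ℂ, (∀ i, Summable fun x => ‖f i x‖) →
    Summable (fun a : ι → A => ‖∏ i, f i (a i)‖) ∧
      HasSum (fun a : ι → A => ∏ i, f i (a i)) (∏ i, ∑' x, f i x)

lemma ProdExpands.of_equiv {α β A : Type} [Fintype α] [Fintype β] (e : α ≃ β)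
    (ih : ProdExpands α A) : ProdExpands β A := by
  intro f hf
  obtain ⟨h1, h2⟩ := ih (fun i => f (e i)) fun i => hf (e i)
  have hprod : ∀ a : β → A, ∏ i : α, f (e i) (a (e i)) = ∏ i, f i (a i) := fun a =>
    Fintype.prod_equiv e _ _ fun _ => rfl
  have hprod' : ∏ i : α, ∑' x, f (e i) x = ∏ i, ∑' x, f i x :=
    Fintype.prod_equiv e _ _ fun _ => rfl
  rw [← (Equiv.arrowCongr e.symm (Equiv.refl A)).summable_iff] at h1
  rw [← (Equiv.arrowCongr e.symm (Equiv.refl A)).hasSum_iff, hprod'] at h2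
  refine ⟨h1.congr fun a => ?_, h2.congr_fun fun a => ?_⟩
  · rw [← hprod]
    rfl
  · rw [← hprod]
    rfl

lemma ProdExpands.option {α A : Type} [Fintype α] (ih : ProdExpands α A) :
    ProdExpands (Option α) A := by
  intro f hf
  obtain ⟨h1, h2⟩ := ih (fun i => f (some i)) fun i => hf (some i)
  have hs := (hf none).mul_of_nonneg h1 (fun _ => norm_nonneg _) (fun _ => norm_nonneg _)
  have hs' : Summable fun x : A × (α → A) => f none x.1 * ∏ i, f (some i) (x.2 i) :=
    Summable.of_norm (hs.congr fun x => (norm_mul _ _).symm)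
  have h3 := (hf none).of_norm.hasSum.mul h2 hs'
  rw [← (Equiv.piOptionEquivProd (β := fun _ : Option α => A)).summable_iff] at hs
  rw [← (Equiv.piOptionEquivProd (β := fun _ : Option α => A)).hasSum_iff] at h3
  refine ⟨hs.congr fun a => ?_, ?_⟩
  · rw [Fintype.prod_option, norm_mul]
    rfl
  · rw [Fintype.prod_option]
    refine h3.congr_fun fun a => ?_
    rw [Fintype.prod_option]
    rfl

/-- Induction over finite types, one point at a time; the step is the product of two absolutely
convergent series. -/
lemma prodExpands (ι A : Type) [Fintype ι] : ProdExpands ι A := by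
  refine Fintype.induction_empty_option (P := fun ι _ => ProdExpands ι A) ?_ ?_ ?_ ι
  · intro α β _ e ih
    exact @ProdExpands.of_equiv α β A (Fintype.ofEquiv β e.symm) _ e ih
  · intro f _
    exact ⟨(hasSum_fintype _).summable, by simp⟩
  · intro α _ ih
    exact ih.option

/-! ### Feynman integrals as sums over flows -/

lemma integral_expTwoPi (m : ℤ) :
    ∫ t in Set.Icc (0 : ℝ) 1, expTwoPi (m * t) = if m = 0 then 1 else 0 := by
  rw [MeasureTheory.integral_Icc_eq_integral_Ioc, ← intervalIntegral.integral_of_le zero_le_one]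
  split_ifs with h
  · simp [h, expTwoPi_zero]
  · have hm : (2 * Real.pi * I * m : ℂ) ≠ 0 := by
      simp [Real.pi_ne_zero, h]
    have := integral_exp_mul_complex (a := 0) (b := 1) hm
    simp only [expTwoPi, ← mul_assoc]
    rw [this]
    have h1 : exp (2 * Real.pi * I * m) = 1 := expTwoPi_intCast m
    simp [h1]

/-- Orthogonality of the characters of a torus. Here the integration becomes the balancing
condition, vertex by vertex. -/
lemma integral_prod_expTwoPi {V : Type} [Fintype V] (m : V → ℤ) :
    ∫ t in Set.Icc (0 : V → ℝ) 1, ∏ v, expTwoPi (m v * t v) = if ∀ v, m v = 0 then 1 else 0 := by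
  classical
  rw [← Set.pi_univ_Icc, MeasureTheory.volume_pi, MeasureTheory.Measure.restrict_pi_pi]
  rw [MeasureTheory.integral_fintype_prod_eq_prod (fun v (t : ℝ) => expTwoPi (m v * t))]
  simp only [Pi.zero_apply, Pi.one_apply, integral_expTwoPi]
  split_ifs with h
  · simp [h]
  · push Not at h
    obtain ⟨v, hv⟩ := h
    exact Finset.prod_eq_zero (Finset.mem_univ v) (if_neg hv)

section FeynmanIntegral

variable {Γ : Multigraph} {y : Γ.V → ℝ} {τ : UpperHalfPlane}

open Classical in
/-- The expansion of the factor of the integrand given by an edge. -/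
def edgeTerm (y : Γ.V → ℝ) (τ : UpperHalfPlane) (t : Γ.V → ℝ) (e : Γ.E) (a : ℤ × ℤ) : ℂ :=
  if Γ.ends e false = Γ.ends e true then (if a = 0 then -propagator 0 τ else 0)
  else fourierTerm ((I * y (Γ.ends e true) + t (Γ.ends e true)) -
    (I * y (Γ.ends e false) + t (Γ.ends e false))) τ a

/-- The condition in `fourierTerm` sees only imaginary parts, so the real shift `t` enters through a
character alone. A loop, whose factor is constant, has its whole value at index `0`. -/
lemma edgeTerm_eq (t : Γ.V → ℝ) (e : Γ.E) (a : ℤ × ℤ) :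
    edgeTerm y τ t e a =
      edgeTerm y τ 0 e a * expTwoPi (a.1 * (t (Γ.ends e true) - t (Γ.ends e false))) := by
  unfold edgeTerm
  split_ifs with h1 h2
  · simp [h2, expTwoPi_zero]
  · simp
  · unfold fourierTerm
    simp only [sub_im, add_im, mul_im, I_re, ofReal_im, I_im, ofReal_re, Pi.zero_apply, ofReal_zero,
      zero_mul, one_mul, zero_add, add_zero]
    split_ifs
    · rw [mul_assoc, ← expTwoPi_add]
      congr 2
      ring
    · simp

lemma norm_edgeTerm (t : Γ.V → ℝ) (e : Γ.E) (a : ℤ × ℤ) :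
    ‖edgeTerm y τ t e a‖ = ‖edgeTerm y τ 0 e a‖ := by
  rw [edgeTerm_eq, norm_mul, norm_expTwoPi]
  simp

lemma edgeTerm_im (t : Γ.V → ℝ) (e : Γ.E) : ((I * y (Γ.ends e true) + t (Γ.ends e true)) -
    (I * y (Γ.ends e false) + t (Γ.ends e false)) : ℂ).im = y (Γ.ends e true) - y (Γ.ends e false) := by
  simp

lemma summable_norm_edgeTerm (hy : Function.Injective y) (hy' : ∀ v w, |y v - y w| < τ.im)
    (t : Γ.V → ℝ) (e : Γ.E) : Summable fun a => ‖edgeTerm y τ t e a‖ := by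
  unfold edgeTerm
  split_ifs with h
  · refine summable_of_ne_finset_zero (s := {0}) fun a ha => ?_
    simp at ha
    simp [ha]
  · apply summable_norm_fourierTerm
    · rw [edgeTerm_im, sub_ne_zero]
      exact fun h' => h (hy h').symm
    · rw [edgeTerm_im]
      exact hy' _ _

lemma hasSum_edgeTerm (hy : Function.Injective y) (hy' : ∀ v w, |y v - y w| < τ.im)
    (t : Γ.V → ℝ) (e : Γ.E) : HasSum (edgeTerm y τ t e)
      (-propagator ((I * y (Γ.ends e false) + t (Γ.ends e false)) -
      (I * y (Γ.ends e true) + t (Γ.ends e true))) τ) := by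
  unfold edgeTerm
  split_ifs with h
  · rw [h, sub_self]
    exact hasSum_ite_eq 0 _
  -- The propagator is even, so the difference may be taken along the reference direction of the
  -- edge.
  · rw [← neg_sub (I * (y (Γ.ends e true) : ℂ) + _), propagator, PeriodPair.weierstrassP_neg]
    apply hasSum_fourierTerm
    · rw [edgeTerm_im, sub_ne_zero]
      exact fun h' => h (hy h').symm
    · rw [edgeTerm_im]
      exact hy' _ _

lemma prod_edgeTerm_eq (t : Γ.V → ℝ) (a : Γ.E → ℤ × ℤ) :
    ∏ e, edgeTerm y τ t e (a e) = (∏ e, edgeTerm y τ 0 e (a e)) *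
      ∏ v, expTwoPi ((-Γ.excess (fun e => (a e).1) v : ℤ) * t v) := by
  rw [← expTwoPi_sum]
  have h := Multigraph.sum_mul_sub_eq (fun e => (a e).1) fun v => (t v : ℂ)
  simp only [Int.cast_neg, neg_mul, Finset.sum_neg_distrib]
  rw [← h, expTwoPi_sum, ← Finset.prod_mul_distrib]
  exact Finset.prod_congr rfl fun e _ => edgeTerm_eq t e (a e)

/-- The contribution of a flow to the Feynman integral. -/
def flowTerm (τ : UpperHalfPlane) (a : Γ.E → ℤ × ℤ) : ℂ :=
  (∏ e, ((a e).1.natAbs : ℂ)) * expTwoPi τ ^ Γ.turns a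

/-- There are no loops, and by balancing the heights `y` cancel; only the powers of `expTwoPi τ`
remain. -/
lemma prod_edgeTerm_of_isFlow (hΓ : Γ.Trivalent) {a : Γ.E → ℤ × ℤ} (ha : Γ.IsFlow y τ.im a) :
    ∏ e, edgeTerm y τ 0 e (a e) = flowTerm τ a := by
  have hl := Multigraph.ends_ne_of_excess_eq_zero hΓ ha.1 fun e _ => ha.fst_ne_zero e
  have h1 : ∀ e, edgeTerm y τ 0 e (a e) = ((a e).1.natAbs : ℂ) *
      expTwoPi ((a e).1 * (I * y (Γ.ends e true) - I * y (Γ.ends e false)) +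
        ((a e).1 * (a e).2 : ℤ) * τ) := by
    intro e
    rw [edgeTerm, if_neg (hl e), fourierTerm, if_pos]
    · congr 2
      simp
      ring
    · rw [edgeTerm_im]
      exact ha.2 e
  have h2 := Multigraph.sum_mul_sub_eq (fun e => (a e).1) fun v => I * (y v : ℂ)
  simp only [ha.1, Int.cast_zero, zero_mul, Finset.sum_const_zero, neg_zero] at h2
  rw [Finset.prod_congr rfl fun e _ => h1 e, Finset.prod_mul_distrib, ← expTwoPi_sum,
    Finset.sum_add_distrib, h2, zero_add, ← Finset.sum_mul, flowTerm, ← expTwoPi_int_mul,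
    Multigraph.turns, Int.cast_sum]

/-- A nonzero factor gives the sign condition only on edges that are not loops; this already
suffices to exclude loops. -/
lemma isFlow_of_prod_edgeTerm_ne_zero (hΓ : Γ.Trivalent) {a : Γ.E → ℤ × ℤ}
    (ha : ∀ v, Γ.excess (fun e => (a e).1) v = 0) (h : ∏ e, edgeTerm y τ 0 e (a e) ≠ 0) :
    Γ.IsFlow y τ.im a := by
  have h1 : ∀ e, Γ.ends e false ≠ Γ.ends e true →
      0 < (a e).1 * (y (Γ.ends e true) - y (Γ.ends e false) + (a e).2 * τ.im) := by
    intro e he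
    have h2 := Finset.prod_ne_zero_iff.1 h e (Finset.mem_univ e)
    rw [edgeTerm, if_neg he, fourierTerm, edgeTerm_im] at h2
    by_contra hn
    exact h2 (if_neg hn)
  refine ⟨ha, fun e => h1 e (Multigraph.ends_ne_of_excess_eq_zero hΓ ha (fun e he h0 => ?_) e)⟩
  have := h1 e he
  simp [h0] at this

open Classical in
-- Expand the product and integrate term by term; the norm of each term is constant in `t`, so
-- absolute convergence at `t = 0` justifies the exchange.
theorem hasSum_feynmanIntegral (hΓ : Γ.Trivalent) (hy : Function.Injective y)
    (hy' : ∀ v w, |y v - y w| < τ.im) :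
    HasSum (fun a => if Γ.IsFlow y τ.im a then flowTerm τ a else 0) (feynmanIntegral Γ y τ) ∧
      Summable fun a => ‖if Γ.IsFlow y τ.im a then flowTerm τ a else 0‖ := by
  have hprod := fun t : Γ.V → ℝ => prodExpands Γ.E (ℤ × ℤ)
    (edgeTerm y τ t) (summable_norm_edgeTerm hy hy' t)
  have hintegral : ∀ a : Γ.E → ℤ × ℤ,
      ∫ t in Set.Icc (0 : Γ.V → ℝ) 1, ∏ e, edgeTerm y τ t e (a e) =
        if Γ.IsFlow y τ.im a then flowTerm τ a else 0 := by
    intro a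
    rw [MeasureTheory.integral_congr_ae (.of_forall fun t => prod_edgeTerm_eq t a),
      MeasureTheory.integral_const_mul, integral_prod_expTwoPi]
    simp only [neg_eq_zero]
    by_cases hc : ∀ v, Γ.excess (fun e => (a e).1) v = 0
    · rw [if_pos hc, mul_one]
      by_cases hf : Γ.IsFlow y τ.im a
      · rw [if_pos hf, prod_edgeTerm_of_isFlow hΓ hf]
      · rw [if_neg hf]
        by_contra h0
        exact hf (isFlow_of_prod_edgeTerm_ne_zero hΓ hc h0)
    · rw [if_neg hc, mul_zero, if_neg fun hf : Γ.IsFlow y τ.im a => hc hf.1]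
  have hnorm : ∀ (a : Γ.E → ℤ × ℤ) (t : Γ.V → ℝ),
      ‖∏ e, edgeTerm y τ t e (a e)‖ = ‖∏ e, edgeTerm y τ 0 e (a e)‖ := by
    intro a t
    simp_rw [norm_prod, norm_edgeTerm]
  have hvol : (MeasureTheory.volume (Set.Icc (0 : Γ.V → ℝ) 1)) = 1 := by
    rw [Real.volume_Icc_pi]
    simp
  have hsum : Summable fun a : Γ.E → ℤ × ℤ => ‖∏ e, edgeTerm y τ 0 e (a e)‖ := (hprod 0).1
  constructor
  · have h := MeasureTheory.hasSum_integral_of_summable_integral_norm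
      (F := fun (a : Γ.E → ℤ × ℤ) (t : Γ.V → ℝ) => ∏ e, edgeTerm y τ t e (a e))
      (μ := MeasureTheory.volume.restrict (Set.Icc (0 : Γ.V → ℝ) 1)) (fun a => ?_) ?_
    · simp_rw [hintegral] at h
      have hF : ∫ t in Set.Icc (0 : Γ.V → ℝ) 1, ∑' a : Γ.E → ℤ × ℤ, ∏ e, edgeTerm y τ t e (a e) =
          feynmanIntegral Γ y τ := by
        unfold feynmanIntegral
        congr 1
        ext t
        rw [(hprod t).2.tsum_eq]
        exact Finset.prod_congr rfl fun e _ => (hasSum_edgeTerm hy hy' t e).tsum_eq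
      rwa [hF] at h
    · rw [funext fun t => prod_edgeTerm_eq t a]
      simp only [expTwoPi]
      refine ContinuousOn.integrableOn_compact isCompact_Icc ?_
      fun_prop
    · simp_rw [hnorm]
      simpa [MeasureTheory.measureReal_def, hvol] using hsum
  · refine hsum.of_nonneg_of_le (fun _ => norm_nonneg _) fun a => ?_
    split_ifs with hf
    · rw [prod_edgeTerm_of_isFlow hΓ hf]
    · rw [norm_zero]
      exact norm_nonneg _

end FeynmanIntegral

/-! ### Flows by number of turns, and their generating series -/

section FlowCount

variable {Γ : Multigraph} {y P : Γ.V → ℝ} {τ : UpperHalfPlane} {ℓ : ℝ}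

/-- The flows that turn `d` times around the circle. -/
def Flows (Γ : Multigraph) (P : Γ.V → ℝ) (ℓ : ℝ) (d : ℕ) : Type :=
  {a : Γ.E → ℤ × ℤ // Γ.IsFlow P ℓ a ∧ Γ.turns a = d}

/-- The number of flows that turn `d` times around the circle, counted with the product of their
slopes. -/
def flowCount (Γ : Multigraph) (P : Γ.V → ℝ) (ℓ : ℝ) (d : ℕ) : ℚ :=
  ∑ᶠ a : Flows Γ P ℓ d, ∏ e, ((a.1 e).1.natAbs : ℚ)

/-- Slopes are nonzero integers, so each such flow contributes a term of norm at least `‖expTwoPi τ‖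
^ d`; a summable family has only finitely many of these. -/
lemma finite_flows_im (hΓ : Γ.Trivalent) (hy : Function.Injective y)
    (hy' : ∀ v w, |y v - y w| < τ.im) (d : ℕ) : Finite (Flows Γ y τ.im d) := by
  classical
  have hpos : 0 < ‖expTwoPi τ‖ ^ d := pow_pos (norm_pos_iff.2 (expTwoPi_ne_zero _)) d
  have h := (hasSum_feynmanIntegral hΓ hy hy').2.tendsto_cofinite_zero.eventually
    (gt_mem_nhds hpos)
  rw [Filter.eventually_cofinite] at h
  refine h.subset fun a ha => ?_
  change ¬ _
  rw [if_pos ha.1, flowTerm, norm_mul, ha.2, zpow_natCast, norm_pow, not_lt, norm_prod]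
  refine le_mul_of_one_le_left hpos.le ?_
  simp_rw [Complex.norm_natCast]
  exact_mod_cast Finset.prod_pos fun e _ => Int.natAbs_pos.2 (ha.1.fst_ne_zero e)

/-- The absolutely convergent sum over all flows is grouped by the number of turns, which is
positive and hence a natural number. -/
lemma hasSum_flowCount_im [Nonempty Γ.E] (hΓ : Γ.Trivalent) (hy : Function.Injective y)
    (hy' : ∀ v w, |y v - y w| < τ.im) :
    HasSum (fun d : ℕ => (flowCount Γ y τ.im d : ℂ) * expTwoPi τ ^ d) (feynmanIntegral Γ y τ) := by
  classical
  have h := (hasSum_feynmanIntegral hΓ hy hy').1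
  let i : (Σ d, Flows Γ y τ.im d) → Γ.E → ℤ × ℤ := fun x => x.2.1
  have hi : Function.Injective i := by
    rintro ⟨d, a⟩ ⟨d', a'⟩ haa
    have h1 : a.1 = a'.1 := haa
    have h2 : d = d' := by
      have h3 := a.2.2
      rw [h1, a'.2.2] at h3
      exact_mod_cast h3.symm
    subst h2
    rw [Subtype.ext h1]
  rw [← hi.hasSum_iff] at h
  · refine h.sigma fun d => ?_
    have := finite_flows_im hΓ hy hy' d
    let := Fintype.ofFinite (Flows Γ y τ.im d)
    convert hasSum_fintype _ using 1
    rw [flowCount, finsum_eq_sum_of_fintype, Rat.cast_sum, Finset.sum_mul]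
    refine Finset.sum_congr rfl fun a _ => ?_
    simp only [i, Function.comp_apply]
    rw [if_pos a.2.1, flowTerm, a.2.2, zpow_natCast]
    push_cast
    rfl
  · intro a ha
    rw [if_neg]
    intro hf
    refine ha ⟨⟨(Γ.turns a).toNat, ⟨a, hf, ?_⟩⟩, rfl⟩
    exact (Int.toNat_of_nonneg (hf.turns_pos τ.im_pos).le).symm

lemma flows_congr (h : ∀ v w, |y v - y w| < τ.im) (h' : ∀ v w, |P v - P w| < ℓ)
    (hyP : ∀ v w, y v < y w ↔ P v < P w) (d : ℕ) : Flows Γ y τ.im d = Flows Γ P ℓ d := by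
  unfold Flows
  congr 1
  ext a
  rw [Multigraph.isFlow_congr h h' hyP]

lemma finite_flows (hΓ : Γ.Trivalent) (hy : Function.Injective y)
    (hy' : ∀ v w, |y v - y w| < τ.im) (h' : ∀ v w, |P v - P w| < ℓ)
    (hyP : ∀ v w, y v < y w ↔ P v < P w) (d : ℕ) : Finite (Flows Γ P ℓ d) := by
  rw [← flows_congr hy' h' hyP]
  exact finite_flows_im hΓ hy hy' d

lemma hasSum_flowCount [Nonempty Γ.E] (hΓ : Γ.Trivalent) (hy : Function.Injective y)
    (hy' : ∀ v w, |y v - y w| < τ.im) (h' : ∀ v w, |P v - P w| < ℓ)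
    (hyP : ∀ v w, y v < y w ↔ P v < P w) :
    HasSum (fun d : ℕ => (flowCount Γ P ℓ d : ℂ) * expTwoPi τ ^ d) (feynmanIntegral Γ y τ) := by
  convert hasSum_flowCount_im hΓ hy hy' using 4 with d
  have : Γ.IsFlow P ℓ = Γ.IsFlow y τ.im := by
    ext a
    rw [Multigraph.isFlow_congr hy' h' hyP]
  unfold flowCount Flows
  rw [this]

lemma flowCount_zero [Nonempty Γ.E] (hℓ : 0 < ℓ) : flowCount Γ P ℓ 0 = 0 := by
  rw [flowCount]
  have : IsEmpty (Flows Γ P ℓ 0) := ⟨fun a => by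
    have := a.2.1.turns_pos hℓ
    simp [a.2.2] at this⟩
  exact finsum_of_isEmpty _

end FlowCount

end Analysis

/-! ### The degree of a cover -/

lemma coe_addCircle_eq_iff {ℓ a b : ℝ} :
    (a : AddCircle ℓ) = b ↔ ∃ n : ℤ, a = b + n * ℓ := by
  rw [← sub_eq_zero, ← AddCircle.coe_sub, AddCircle.coe_eq_zero_iff]
  simp only [zsmul_eq_mul]
  constructor
  · rintro ⟨n, hn⟩
    exact ⟨n, by linarith⟩
  · rintro ⟨n, hn⟩
    exact ⟨n, by linarith⟩

lemma eq_of_coe_addCircle_eq {ℓ a b : ℝ} (ha : a ∈ Set.Ico 0 ℓ) (hb : b ∈ Set.Ico 0 ℓ)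
    (h : (a : AddCircle ℓ) = b) : a = b := by
  have : Fact (0 < ℓ) := ⟨ha.1.trans_lt ha.2⟩
  have ha' : a ∈ Set.Ico 0 (0 + ℓ) := by simpa using ha
  have hb' : b ∈ Set.Ico 0 (0 + ℓ) := by simpa using hb
  exact (AddCircle.coe_eq_coe_iff_of_mem_Ico ha' hb').1 h

lemma exists_coe_addCircle_eq {ℓ : ℝ} (hℓ : 0 < ℓ) (x : AddCircle ℓ) :
    ∃ a ∈ Set.Ico 0 ℓ, (a : AddCircle ℓ) = x := by
  have : Fact (0 < ℓ) := ⟨hℓ⟩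
  have h := (AddCircle.equivIco ℓ 0 x).2
  exact ⟨(AddCircle.equivIco ℓ 0 x).1, by simpa using h, AddCircle.coe_equivIco⟩

/-- The number of turns after which a point `A` of `[0, ℓ)` is passed by a point `X ≠ A`. -/
def passing (X A : ℝ) : ℤ := if A < X then 0 else 1

/-- Thus `m + passing X A` is the index of the first lift of `X` beyond `A + m * ℓ`. -/
lemma add_mul_lt_add_mul_iff {ℓ A X : ℝ} (hA : A ∈ Set.Ico 0 ℓ) (hX : X ∈ Set.Ico 0 ℓ) (hAX : A ≠ X)
    (m k : ℤ) : A + m * ℓ < X + k * ℓ ↔ m + passing X A ≤ k := by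
  have hℓ : 0 < ℓ := hA.1.trans_lt hA.2
  unfold passing
  split_ifs with h
  · rw [add_zero]
    constructor
    · intro h1
      by_contra! h2
      have h3 : (k : ℝ) + 1 ≤ m := by exact_mod_cast h2
      nlinarith [hA.1, hX.2]
    · intro h1
      have h3 : (m : ℝ) ≤ k := by exact_mod_cast h1
      nlinarith
  · have h' : X < A := lt_of_le_of_ne (not_lt.1 h) hAX.symm
    constructor
    · intro h1
      by_contra! h2
      have h3 : (k : ℝ) ≤ m := by exact_mod_cast Int.lt_add_one_iff.1 h2
      nlinarith
    · intro h1
      have h3 : (m : ℝ) + 1 ≤ k := by exact_mod_cast h1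
      nlinarith [hA.2, hX.1]

lemma add_mul_lt_add_mul_iff' {ℓ A X : ℝ} (hA : A ∈ Set.Ico 0 ℓ) (hX : X ∈ Set.Ico 0 ℓ)
    (hAX : A ≠ X) (m k : ℤ) : X + k * ℓ < A + m * ℓ ↔ k < m + passing X A := by
  rw [← not_le, ← not_iff_not, not_not, not_lt, ← add_mul_lt_add_mul_iff hA hX hAX]
  refine ⟨fun h => lt_of_le_of_ne h fun heq => hAX ?_, le_of_lt⟩
  exact eq_of_coe_addCircle_eq hA hX (coe_addCircle_eq_iff.2 ⟨k - m, by push_cast; linarith⟩)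

/-- The edge lifts to a segment from `A` to `B + n * ℓ`, and preimages of `X` are the lifts of `X`
strictly inside. Their signed number has the sign of `s`. -/
lemma ncard_preimages_mul {ℓ A B X L : ℝ} {s n : ℤ} (hA : A ∈ Set.Ico 0 ℓ) (hB : B ∈ Set.Ico 0 ℓ)
    (hX : X ∈ Set.Ico 0 ℓ) (hAX : A ≠ X) (hBX : B ≠ X) (hL : 0 < L) (hs : s ≠ 0)
    (h : s * L = B - A + n * ℓ) :
    (Set.ncard {t : ℝ | t ∈ Set.Ioo 0 L ∧ (A : AddCircle ℓ) + ((s * t : ℝ) : AddCircle ℓ) = X} *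
      s.natAbs : ℤ) = s * (n + (passing X B - passing X A)) := by
  have hℓ : 0 < ℓ := hA.1.trans_lt hA.2
  have hs' : (s : ℝ) ≠ 0 := by exact_mod_cast hs
  have hinj : Function.Injective fun k : ℤ => (X + k * ℓ - A) / s := by
    intro k k' hk
    have h1 : X + k * ℓ - A = X + k' * ℓ - A := (div_left_inj' hs').1 hk
    have h2 : (k : ℝ) = k' := mul_right_cancel₀ hℓ.ne' (by linarith)
    exact_mod_cast h2
  have hset : {t : ℝ | t ∈ Set.Ioo 0 L ∧ (A : AddCircle ℓ) + ((s * t : ℝ) : AddCircle ℓ) = X} =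
      (fun k : ℤ => (X + k * ℓ - A) / s) '' {k : ℤ | (X + k * ℓ - A) / s ∈ Set.Ioo 0 L} := by
    ext t
    simp only [Set.mem_ofPred_eq, Set.mem_image, ← AddCircle.coe_add, coe_addCircle_eq_iff]
    constructor
    · rintro ⟨ht, k, hk⟩
      have : (X + k * ℓ - A) / s = t := by
        rw [← hk]
        field_simp
        ring
      exact ⟨k, by rwa [this], this⟩
    · rintro ⟨k, hk, rfl⟩
      refine ⟨hk, k, ?_⟩
      field_simp
      ring
  rw [hset, Set.ncard_image_of_injective _ hinj]
  have hA0 := add_mul_lt_add_mul_iff hA hX hAX 0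
  have hA1 := add_mul_lt_add_mul_iff' hA hX hAX 0
  have hB0 := add_mul_lt_add_mul_iff hB hX hBX n
  have hB1 := add_mul_lt_add_mul_iff' hB hX hBX n
  simp only [Int.cast_zero, zero_mul, add_zero, zero_add] at hA0 hA1
  have hpA : 0 ≤ passing X A ∧ passing X A ≤ 1 := by unfold passing; split_ifs <;> simp
  have hpB : 0 ≤ passing X B ∧ passing X B ≤ 1 := by unfold passing; split_ifs <;> simp
  -- These comparisons settle the case `n = 0`, where they show that the integer interval of indices
  -- has nonnegative length, so that `Int.toNat` does not truncate.
  have hmono : A ≤ B → passing X A ≤ passing X B := by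
    intro hAB
    unfold passing
    split_ifs <;> first | (exfalso; linarith) | simp
  have hmono' : B ≤ A → passing X B ≤ passing X A := by
    intro hAB
    unfold passing
    split_ifs <;> first | (exfalso; linarith) | simp
  rcases hs.lt_or_gt with hneg | hpos
  · have hneg' : (s : ℝ) < 0 := by exact_mod_cast hneg
    have hI : {k : ℤ | (X + k * ℓ - A) / s ∈ Set.Ioo 0 L} =
        ((Finset.Ico (n + passing X B) (passing X A) : Finset ℤ) : Set ℤ) := by
      ext k
      simp only [Set.mem_ofPred_eq, Set.mem_Ioo, Finset.coe_Ico, Set.mem_Ico, ← hB0, ← hA1]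
      rw [div_lt_iff_of_neg hneg', lt_div_iff_of_neg hneg']
      constructor <;> rintro ⟨h1, h2⟩ <;> constructor <;> linarith
    rw [hI, Set.ncard_coe_finset, Int.card_Ico, Int.ofNat_natAbs_of_nonpos hneg.le,
      Int.toNat_of_nonneg]
    · ring
    · have h1 : B - A + n * ℓ < 0 := by
        rw [← h]
        exact mul_neg_of_neg_of_pos hneg' hL
      have hn : n < 1 := by
        by_contra! hn
        have : (1 : ℝ) ≤ n := by exact_mod_cast hn
        nlinarith [hA.2, hB.1]
      rcases eq_or_lt_of_le (Int.lt_add_one_iff.1 (by simpa using hn) : n ≤ 0) with rfl | hn'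
      · have := hmono' (by simp at h1; linarith)
        linarith
      · linarith
  · have hpos' : (0 : ℝ) < s := by exact_mod_cast hpos
    have hI : {k : ℤ | (X + k * ℓ - A) / s ∈ Set.Ioo 0 L} =
        ((Finset.Ico (passing X A) (n + passing X B) : Finset ℤ) : Set ℤ) := by
      ext k
      simp only [Set.mem_ofPred_eq, Set.mem_Ioo, Finset.coe_Ico, Set.mem_Ico, ← hB1, ← hA0]
      rw [div_lt_iff₀ hpos', lt_div_iff₀ hpos']
      constructor <;> rintro ⟨h1, h2⟩ <;> constructor <;> linarith
    rw [hI, Set.ncard_coe_finset, Int.card_Ico, Int.natAbs_of_nonneg hpos.le, Int.toNat_of_nonneg]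
    · ring
    · have h1 : 0 < B - A + n * ℓ := by
        rw [← h]
        exact mul_pos hpos' hL
      have hn : -1 < n := by
        by_contra! hn
        have : (n : ℝ) ≤ -1 := by exact_mod_cast hn
        nlinarith [hA.1, hB.2]
      rcases eq_or_lt_of_le (by linarith [Int.add_one_le_iff.2 hn] : 0 ≤ n) with rfl | hn'
      · have := hmono (by simp at h1; linarith)
        linarith
      · linarith [Int.add_one_le_iff.2 hn']

lemma PreCover.balanced_iff {ℓ : ℝ} (π : PreCover ℓ) :
    π.Balanced ↔ ∀ v, π.C.excess π.slope v = 0 := by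
  classical
  refine forall_congr' fun v => ?_
  have h : π.C.excess π.slope v =
      ((∑ x : π.C.E × Bool with π.C.ends x.1 x.2 = v ∧ 0 < π.raySlope x.1 x.2, π.weight x.1 : ℕ) : ℤ) -
      ((∑ x : π.C.E × Bool with π.C.ends x.1 x.2 = v ∧ π.raySlope x.1 x.2 < 0, π.weight x.1 : ℕ) : ℤ) := by
    rw [Multigraph.excess]
    push_cast
    rw [← Finset.filter_filter, ← Finset.filter_filter, Finset.sum_filter (p := fun x => 0 < _),
      Finset.sum_filter (p := fun x => _ < 0), ← Finset.sum_sub_distrib]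
    refine Finset.sum_congr (by congr) fun x _ => ?_
    obtain ⟨e, b⟩ := x
    have hw : (π.weight e : ℤ) = |π.raySlope e b| := by
      cases b <;> simp [PreCover.weight, PreCover.raySlope]
    have hr : π.C.halfFlow π.slope (e, b) = π.raySlope e b := by
      cases b <;> simp [Multigraph.halfFlow, PreCover.raySlope]
    simp only [hw, hr]
    rcases lt_trichotomy (π.raySlope e b) 0 with h | h | h
    · rw [if_neg (not_lt.2 h.le), if_pos h, abs_of_neg h]
      ring
    · simp [h]
    · rw [if_pos h, if_neg (not_lt.2 h.le), abs_of_pos h]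
      ring
  rw [h, sub_eq_zero, Nat.cast_inj]
  constructor
  · intro h1
    convert h1.symm
  · intro h1
    convert h1.symm

/-- Summed over the edges, the `passing` terms cancel by balancing, so the weighted number of
preimages is the same for every point. -/
lemma PreCover.hasDegree_iff {ℓ : ℝ} (hℓ : 0 < ℓ) (π : PreCover ℓ) {P : π.C.V → ℝ}
    (hP : ∀ v, P v ∈ Set.Ico 0 ℓ) (hPv : ∀ v, π.vmap v = P v) {n : π.C.E → ℤ}
    (hn : ∀ e, π.slope e * π.C.length e =
      P (π.C.ends e true) - P (π.C.ends e false) + n e * ℓ)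
    (hs : ∀ e, π.slope e ≠ 0) (hb : ∀ v, π.C.excess π.slope v = 0) (d : ℕ) :
    π.HasDegree d ↔ ∑ e, π.slope e * n e = d := by
  have key : ∀ x : AddCircle ℓ, (∀ v, π.vmap v ≠ x) →
      ((∑ e, Set.ncard {t : ℝ | t ∈ Set.Ioo 0 (π.C.length e) ∧ π.edgeMap e t = x} *
        π.weight e : ℕ) : ℤ) = ∑ e, π.slope e * n e := by
    intro x hx
    obtain ⟨X, hX, rfl⟩ := exists_coe_addCircle_eq hℓ x
    have hne : ∀ v, P v ≠ X := fun v h => hx v (by rw [hPv, h])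
    push_cast
    have h0 := Multigraph.sum_mul_sub_eq (R := ℤ) π.slope fun v => passing X (P v)
    simp only [hb, Int.cast_zero, zero_mul, Finset.sum_const_zero, neg_zero, Int.cast_id] at h0
    rw [← add_zero (∑ e, π.slope e * n e), ← h0, ← Finset.sum_add_distrib]
    refine Finset.sum_congr rfl fun e _ => ?_
    rw [← mul_add, ← ncard_preimages_mul (hP _) (hP _) hX (hne _) (hne _) (π.C.length_pos e) (hs e)
      (hn e)]
    simp only [PreCover.edgeMap, hPv]
    rfl
  constructor
  · intro h
    -- At least one point must avoid the images of the vertices, or the degree condition would be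
    -- vacuous.
    have hinf : (Set.Ioo 0 ℓ \ Set.range P).Infinite :=
      (Set.Ioo_infinite hℓ).sdiff (Set.finite_range P)
    obtain ⟨X, hX, hX'⟩ := hinf.nonempty
    have hx : ∀ v, π.vmap v ≠ (X : AddCircle ℓ) := by
      intro v hv
      rw [hPv] at hv
      exact hX' ⟨v, eq_of_coe_addCircle_eq (hP v) ⟨hX.1.le, hX.2⟩ hv⟩
    rw [← key _ hx, h _ hx]
  · intro h x hx
    have := key x hx
    rw [h] at this
    exact_mod_cast this

/-! ### Isomorphisms of graphs and of covers -/

namespace Multigraph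

variable {G G' G'' : Multigraph}

lemma Iso.trans_right_injective (φ : Iso G G') :
    Function.Injective fun ψ : Iso G' G'' => φ.trans ψ := by
  intro ψ ψ' h
  have hv : ∀ v, ψ.vert (φ.vert v) = ψ'.vert (φ.vert v) := fun v =>
    congrArg (fun χ : Iso G G'' => χ.vert v) h
  have he : ∀ e, ψ.edge (φ.edge e) = ψ'.edge (φ.edge e) := fun e =>
    congrArg (fun χ : Iso G G'' => χ.edge e) h
  have hf : ∀ e, xor (φ.flip e) (ψ.flip (φ.edge e)) = xor (φ.flip e) (ψ'.flip (φ.edge e)) :=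
    fun e => congrArg (fun χ : Iso G G'' => χ.flip e) h
  refine Iso.ext (Equiv.ext fun v => ?_) (Equiv.ext fun e => ?_) (funext fun e => ?_)
  · obtain ⟨v, rfl⟩ := φ.vert.surjective v
    exact hv v
  · obtain ⟨e, rfl⟩ := φ.edge.surjective e
    exact he e
  · obtain ⟨e, rfl⟩ := φ.edge.surjective e
    exact Bool.xor_right_inj.1 (hf e)

instance : Finite (Iso G G') := by
  classical
  refine Finite.of_injective (fun φ : Iso G G' => (φ.vert, φ.edge, φ.flip)) fun φ ψ h => ?_
  simp only [Prod.mk.injEq] at h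
  exact Iso.ext h.1 h.2.1 h.2.2

lemma Trivalent.exists_ends_eq (hG : G.Trivalent) (v : G.V) : ∃ e b, G.ends e b = v := by
  have h : Nat.card {x : G.E × Bool // G.ends x.1 x.2 = v} ≠ 0 := by simp [hG v]
  obtain ⟨⟨x, hx⟩⟩ := (Nat.card_ne_zero.1 h).1
  exact ⟨x.1, x.2, hx⟩

/-- The pull-back of oriented data on the edges. -/
def Iso.pull (φ : Iso G G') (s : G'.E → ℤ) (e : G.E) : ℤ :=
  if φ.flip e then -s (φ.edge e) else s (φ.edge e)

lemma Iso.excess_pull (φ : Iso G G') (s : G'.E → ℤ) (v : G.V) :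
    G.excess (φ.pull s) v = G'.excess s (φ.vert v) := by
  classical
  unfold excess
  refine Finset.sum_bij' (fun x _ => (φ.edge x.1, xor x.2 (φ.flip x.1)))
    (fun x _ => (φ.edge.symm x.1, xor x.2 (φ.flip (φ.edge.symm x.1)))) ?_ ?_ ?_ ?_ ?_
  · intro x hx
    simp only [Finset.mem_filter, Finset.mem_univ, true_and] at hx ⊢
    rw [φ.ends_eq, hx]
  · intro x hx
    simp only [Finset.mem_filter, Finset.mem_univ, true_and] at hx ⊢
    apply φ.vert.injective
    rw [← φ.ends_eq, ← hx]
    simp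
  · intro x _
    simp
  · intro x _
    simp
  · intro x _
    obtain ⟨e, b⟩ := x
    simp only [halfFlow, Iso.pull]
    cases b <;> cases φ.flip e <;> simp

lemma Iso.sum_pull_mul_pull (φ : Iso G G') (s n : G'.E → ℤ) :
    ∑ e, φ.pull s e * φ.pull n e = ∑ e, s e * n e := by
  refine Fintype.sum_equiv φ.edge _ _ fun e => ?_
  unfold Iso.pull
  split_ifs <;> ring

end Multigraph

/-- If `s ≠ s'`, a small `t > 0` makes `(s - s') * t` nonzero of absolute value at most `ℓ / 2`,
hence not a multiple of `ℓ`. -/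
lemma eq_of_forall_coe_mul_eq {ℓ L : ℝ} (hℓ : 0 < ℓ) (hL : 0 < L) {s s' : ℤ}
    (h : ∀ t ∈ Set.Icc 0 L, ((s * t : ℝ) : AddCircle ℓ) = ((s' * t : ℝ) : AddCircle ℓ)) :
    s = s' := by
  by_contra hne
  have hm : (s - s' : ℝ) ≠ 0 := by
    rw [sub_ne_zero]
    exact_mod_cast hne
  have hm' : 0 < |(s - s' : ℝ)| := abs_pos.2 hm
  set t := min L (ℓ / (2 * |(s - s' : ℝ)|)) with ht
  have ht0 : 0 < t := lt_min hL (by positivity)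
  obtain ⟨k, hk⟩ := coe_addCircle_eq_iff.1 (h t ⟨ht0.le, min_le_left _ _⟩)
  have h1 : (s - s' : ℝ) * t = k * ℓ := by linarith
  have h2 : |(s - s' : ℝ)| * t ≤ ℓ / 2 := by
    calc |(s - s' : ℝ)| * t ≤ |(s - s' : ℝ)| * (ℓ / (2 * |(s - s' : ℝ)|)) := by
          gcongr
          exact min_le_right _ _
      _ = ℓ / 2 := by field_simp
  have h3 : |(s - s' : ℝ)| * t = |(k : ℝ)| * ℓ := by
    rw [← abs_of_pos hℓ, ← abs_mul, ← h1, abs_mul, abs_of_pos ht0]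
  have hk0 : k ≠ 0 := by
    rintro rfl
    simp only [Int.cast_zero, abs_zero, zero_mul] at h3
    have := mul_pos hm' ht0
    linarith
  have hk1 : (1 : ℝ) ≤ |(k : ℝ)| := by exact_mod_cast Int.one_le_abs hk0
  nlinarith

namespace PreCover

variable {ℓ : ℝ} (π : PreCover ℓ)

lemma edgeMap_flipCoord (e : π.C.E) (b : Bool) (t : ℝ) :
    π.edgeMap e (flipCoord b (π.C.length e) t) =
      π.vmap (π.C.ends e b) + ((π.raySlope e b * t : ℝ) : AddCircle ℓ) := by
  cases b
  · simp [edgeMap, flipCoord, raySlope]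
  · simp only [edgeMap, flipCoord, raySlope, if_true, π.continuous_eq e, add_assoc,
      ← AddCircle.coe_add]
    congr 2
    push_cast
    ring

end PreCover

namespace TropicalCover

variable {ℓ : ℝ} {π π' π'' : TropicalCover ℓ}

lemma Iso.toIso_injective : Function.Injective fun φ : Iso π π' => φ.toIso := by
  intro φ ψ h
  obtain ⟨⟨φ, _⟩, _⟩ := φ
  obtain ⟨⟨ψ, _⟩, _⟩ := ψ
  simp only at h
  subst h
  rfl

instance : Finite (Iso π π') := Finite.of_injective _ Iso.toIso_injective

lemma Iso.trans_right_injective (φ : Iso π π') :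
    Function.Injective fun ψ : Iso π' π'' => φ.trans ψ := fun _ _ h =>
  Iso.toIso_injective (φ.toIso.trans_right_injective
    (congrArg (fun χ : Iso π π'' => χ.toIso) h))

lemma Iso.card_eq (φ : Iso π π') : Nat.card (Iso π π'') = Nat.card (Iso π' π'') :=
  le_antisymm (Nat.card_le_card_of_injective _ φ.symm.trans_right_injective)
    (Nat.card_le_card_of_injective _ φ.trans_right_injective)

/-- Compatibility is given on edges only; by trivalence every vertex is an end of some edge, and the
condition is read off at that end. -/
lemma Iso.vmap_eq (φ : Iso π π') (v : π.C.V) : π'.vmap (φ.vert v) = π.vmap v := by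
  obtain ⟨e, b, rfl⟩ := π.C.trivalent.exists_ends_eq v
  have hmem : flipCoord b (π.C.length e) 0 ∈ Set.Icc 0 (π.C.length e) := by
    cases b <;> simp [flipCoord, (π.C.length_pos e).le]
  have h := φ.map_eq e _ hmem
  have hflip : flipCoord (φ.flip e) (π.C.length e) (flipCoord b (π.C.length e) 0) =
      flipCoord (xor b (φ.flip e)) (π'.C.length (φ.edge e)) 0 := by
    rw [φ.length_eq]
    cases b <;> cases φ.flip e <;> simp [flipCoord]
  rw [hflip, PreCover.edgeMap_flipCoord, PreCover.edgeMap_flipCoord, φ.ends_eq] at h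
  simpa using h

lemma Iso.slope_eq (hℓ : 0 < ℓ) (φ : Iso π π') (e : π.C.E) :
    π.slope e = φ.pull π'.slope e := by
  refine eq_of_forall_coe_mul_eq hℓ (π.C.length_pos e) fun t ht => ?_
  have h := φ.map_eq e t ht
  rw [← φ.length_eq, PreCover.edgeMap_flipCoord] at h
  have h1 := φ.ends_eq e false
  rw [Bool.false_xor] at h1
  rw [h1, φ.vmap_eq, PreCover.edgeMap] at h
  exact (add_left_cancel h).symm

lemma Iso.prod_weight_eq (hℓ : 0 < ℓ) (φ : Iso π π') :
    ∏ e, (π.weight e : ℚ) = ∏ e, (π'.weight e : ℚ) := by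
  refine Fintype.prod_equiv φ.edge _ _ fun e => ?_
  rw [PreCover.weight, PreCover.weight, φ.slope_eq hℓ, Multigraph.Iso.pull]
  split_ifs <;> simp

/-- An isomorphism of covers from an isomorphism of graphs. -/
def Iso.ofGraphIso (φ : Multigraph.Iso π.C.toMultigraph π'.C.toMultigraph)
    (hlen : ∀ e, π'.C.length (φ.edge e) = π.C.length e)
    (hv : ∀ v, π'.vmap (φ.vert v) = π.vmap v)
    (hs : ∀ e, π.slope e = φ.pull π'.slope e) : Iso π π' where
  toIso := φ
  length_eq := hlen
  map_eq := fun e t _ => by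
    have h1 := φ.ends_eq e false
    rw [Bool.false_xor] at h1
    rw [← hlen, PreCover.edgeMap_flipCoord, h1, hv, PreCover.edgeMap, hs e]
    rfl

end TropicalCover

/-! ### The cover given by a flow -/

/-- The cover given by a flow on a graph whose vertices are placed at `P`. -/
def coverOfFlow {Γ : Multigraph} (hc : Γ.Connected) (ht : Γ.Trivalent) (hE : Nonempty Γ.E)
    {P : Γ.V → ℝ} {ℓ : ℝ} {a : Γ.E → ℤ × ℤ} (ha : Γ.IsFlow P ℓ a) : TropicalCover ℓ where
  C :=
    { toMultigraph := Γ
      connected := hc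
      trivalent := ht
      -- The length is forced: slope times length is the displacement. Its positivity is the sign
      -- condition of a flow.
      length := fun e => (P (Γ.ends e true) - P (Γ.ends e false) + (a e).2 * ℓ) / (a e).1
      length_pos := fun e => by
        rcases mul_pos_iff.1 (ha.2 e) with h | h
        · exact div_pos h.2 h.1
        · exact div_pos_of_neg_of_neg h.2 h.1 }
  vmap := fun v => P v
  slope := fun e => (a e).1
  continuous_eq := fun e => by
    have h : ((a e).1 : ℝ) ≠ 0 := by exact_mod_cast ha.fst_ne_zero e
    simp only
    rw [mul_div_cancel₀ _ h, ← AddCircle.coe_add, coe_addCircle_eq_iff]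
    exact ⟨-(a e).2, by push_cast; ring⟩
  nonConstant := ⟨hE.some, ha.fst_ne_zero _⟩
  balanced := (PreCover.balanced_iff _).2 ha.1

lemma slope_mul_length_coverOfFlow {Γ : Multigraph} (hc : Γ.Connected) (ht : Γ.Trivalent)
    (hE : Nonempty Γ.E) {P : Γ.V → ℝ} {ℓ : ℝ} {a : Γ.E → ℤ × ℤ} (ha : Γ.IsFlow P ℓ a) (e : Γ.E) :
    ((a e).1 : ℝ) * (coverOfFlow hc ht hE ha).C.length e =
      P (Γ.ends e true) - P (Γ.ends e false) + (a e).2 * ℓ := by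
  have h : ((a e).1 : ℝ) ≠ 0 := by exact_mod_cast ha.fst_ne_zero e
  exact mul_div_cancel₀ _ h

/-- Both sides count half-edges; with the genus this fixes the numbers of vertices and edges. -/
lemma three_mul_card_eq {G : Multigraph} (hG : G.Trivalent) :
    3 * Fintype.card G.V = 2 * Fintype.card G.E := by
  classical
  have h : Fintype.card (G.E × Bool) =
      ∑ v, Fintype.card {x : G.E × Bool // G.ends x.1 x.2 = v} := by
    rw [← Fintype.card_sigma]
    exact Fintype.card_congr (Equiv.sigmaFiberEquiv fun x : G.E × Bool => G.ends x.1 x.2).symm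
  have h3 : ∀ v, Fintype.card {x : G.E × Bool // G.ends x.1 x.2 = v} = 3 := fun v => by
    rw [← Nat.card_eq_fintype_card]
    exact hG v
  simp only [h3, Fintype.card_prod, Fintype.card_bool, Finset.sum_const, Finset.card_univ,
    smul_eq_mul] at h
  omega

/-! ### Markings of a Feynman graph and the covers they give -/

section

variable {g : ℕ}

lemma card_vert_of_genus_eq {G : Multigraph} (hG : G.Trivalent) (hg : G.genus = g) :
    Fintype.card G.V = 2 * g - 2 := by
  have := three_mul_card_eq hG
  unfold Multigraph.genus at hg
  omega

lemma card_edge_of_genus_eq {G : Multigraph} (hG : G.Trivalent) (hg : G.genus = g) :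
    Fintype.card G.E = 3 * g - 3 := by
  have := three_mul_card_eq hG
  unfold Multigraph.genus at hg
  omega

lemma FeynmanGraph.card_vert (Γ : FeynmanGraph g) : Fintype.card Γ.1.V = 2 * g - 2 :=
  card_vert_of_genus_eq Γ.2.2.1 Γ.2.2.2

lemma FeynmanGraph.nonempty_edge (Γ : FeynmanGraph g) : Nonempty Γ.1.E := by
  obtain ⟨e, _⟩ := Γ.2.2.1.exists_ends_eq Γ.2.1.1.some
  exact ⟨e⟩

/-- The vertices placed at the numbers `r`, in the order `Ω`. -/
def position (Γ : FeynmanGraph g) (r : Fin (2 * g - 2) → ℝ) (Ω : VertexOrder Γ.1) (v : Γ.1.V) : ℝ :=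
  r (Fin.cast Γ.card_vert (Ω v))

/-- An order of the vertices and a flow that turns `d` times around the circle. -/
abbrev Marking (Γ : FeynmanGraph g) (r : Fin (2 * g - 2) → ℝ) (ℓ : ℝ) (d : ℕ) : Type :=
  Σ Ω : VertexOrder Γ.1, Flows Γ.1 (position Γ r Ω) ℓ d

variable {Γ : FeynmanGraph g} {r : Fin (2 * g - 2) → ℝ} {ℓ : ℝ} {d : ℕ}

/-- The cover given by a marking. -/
def Marking.cover (x : Marking Γ r ℓ d) : TropicalCover ℓ :=
  coverOfFlow Γ.2.1 Γ.2.2.1 Γ.nonempty_edge x.2.2.1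

lemma Marking.cover_prop (hℓ : 0 < ℓ) (hr : ∀ i, r i ∈ Set.Ico 0 ℓ) (x : Marking Γ r ℓ d) :
    x.cover.C.genus = g ∧ x.cover.HasDegree d ∧
      Set.range x.cover.vmap = Set.range fun i => (r i : AddCircle ℓ) := by
  refine ⟨Γ.2.2.2, ?_, ?_⟩
  · refine (PreCover.hasDegree_iff hℓ x.cover.toPreCover (P := position Γ r x.1)
      (n := fun e => (x.2.1 e).2)
      (fun v => hr _) (fun v => rfl)
      (slope_mul_length_coverOfFlow Γ.2.1 Γ.2.2.1 Γ.nonempty_edge x.2.2.1)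
      x.2.2.1.fst_ne_zero x.2.2.1.1 d).2 x.2.2.2
  · ext z
    constructor
    · rintro ⟨v, rfl⟩
      exact ⟨_, rfl⟩
    · rintro ⟨i, rfl⟩
      refine ⟨x.1.symm (Fin.cast Γ.card_vert.symm i), ?_⟩
      change ((position Γ r x.1 _ : ℝ) : AddCircle ℓ) = _
      simp [position]

/-- The isomorphism from `Γ` that underlies an isomorphism from the cover of a marking. -/
def Marking.graphIso {π : TropicalCover ℓ} {x : Marking Γ r ℓ d} (φ : TropicalCover.Iso x.cover π) :
    Multigraph.Iso Γ.1 π.C.toMultigraph :=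
  φ.toIso

lemma Marking.vmap_graphIso {π : TropicalCover ℓ} {x : Marking Γ r ℓ d}
    (φ : TropicalCover.Iso x.cover π) (v : Γ.1.V) :
    π.vmap ((graphIso φ).vert v) = (position Γ r x.1 v : AddCircle ℓ) :=
  φ.vmap_eq v

lemma Marking.pull_graphIso (hℓ : 0 < ℓ) {π : TropicalCover ℓ} {x : Marking Γ r ℓ d}
    (φ : TropicalCover.Iso x.cover π) (e : Γ.1.E) :
    (graphIso φ).pull π.slope e = (x.2.1 e).1 :=
  (φ.slope_eq hℓ e).symm

lemma Marking.length_graphIso {π : TropicalCover ℓ} {x : Marking Γ r ℓ d}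
    (φ : TropicalCover.Iso x.cover π) (e : Γ.1.E) :
    ((x.2.1 e).1 : ℝ) * π.C.length ((graphIso φ).edge e) = position Γ r x.1 (Γ.1.ends e true) -
      position Γ r x.1 (Γ.1.ends e false) + (x.2.1 e).2 * ℓ :=
  (congrArg (((x.2.1 e).1 : ℝ) * ·) (φ.length_eq e)).trans
    (slope_mul_length_coverOfFlow Γ.2.1 Γ.2.2.1 Γ.nonempty_edge x.2.2.1 e)

/-- Two markings whose covers agree under the same isomorphism of graphs are equal. -/
lemma Marking.eq_of_graphIso_eq (hℓ : 0 < ℓ) (hr : ∀ i, r i ∈ Set.Ico 0 ℓ) (hr' : StrictMono r)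
    {π : TropicalCover ℓ} {x x' : Marking Γ r ℓ d} (φ : TropicalCover.Iso x.cover π)
    (φ' : TropicalCover.Iso x'.cover π) (h : graphIso φ = graphIso φ') : x = x' := by
  have hv := vmap_graphIso φ
  have hv' := vmap_graphIso φ'
  have hs := pull_graphIso hℓ φ
  have hs' := pull_graphIso hℓ φ'
  have hl := length_graphIso φ
  have hl' := length_graphIso φ'
  rw [← h] at hv' hs' hl'
  clear h
  generalize graphIso φ = ψ at *
  clear φ φ'
  obtain ⟨Ω, a, ha⟩ := x
  obtain ⟨Ω', a', ha'⟩ := x'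
  -- Representatives in `[0, ℓ)` are unique and `r` is injective, so the images of the vertices
  -- recover the order. The slopes, and then the winding numbers, are read off from the cover.
  have hΩ : Ω = Ω' := by
    ext1 v
    have h3 : position Γ r Ω v = position Γ r Ω' v :=
      eq_of_coe_addCircle_eq (hr _) (hr _) ((hv v).symm.trans (hv' v))
    exact Fin.cast_injective _ (hr'.injective h3)
  subst hΩ
  have haa : a = a' := by
    funext e
    have h1 : (a e).1 = (a' e).1 := (hs e).symm.trans (hs' e)
    have h2 := hl e
    have h3 := hl' e
    simp only at h2 h3
    rw [← h1, h2] at h3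
    have h4 : ((a e).2 : ℝ) = (a' e).2 := mul_right_cancel₀ hℓ.ne' (by linarith)
    exact Prod.ext h1 (by exact_mod_cast h4)
  subst haa
  rfl

/-- On a cover whose vertices have pairwise distinct images, no edge is contracted. -/
lemma TropicalCover.slope_ne_zero {π : TropicalCover ℓ} (hπ : Function.Injective π.vmap)
    (e : π.C.E) : π.slope e ≠ 0 := by
  -- A contracted edge that is not a loop would identify the images of two vertices; loops are then
  -- excluded by balancing.
  have h : ∀ e, π.C.ends e false ≠ π.C.ends e true → π.slope e ≠ 0 := by
    intro e he h0
    have := π.continuous_eq e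
    simp only [h0, Int.cast_zero, zero_mul, AddCircle.coe_zero, add_zero] at this
    exact he (hπ this).symm
  exact h e (Multigraph.ends_ne_of_excess_eq_zero π.C.trivalent
    ((PreCover.balanced_iff _).1 π.balanced) h e)

/-- Every isomorphism from `Γ` to the source of a cover comes from a marking of `Γ`. -/
lemma exists_marking (hℓ : 0 < ℓ) (hr : ∀ i, r i ∈ Set.Ico 0 ℓ) (hr' : StrictMono r)
    {π : TropicalCover ℓ} (hπ : π.HasDegree d)
    (hπ' : Set.range π.vmap = Set.range fun i => (r i : AddCircle ℓ))
    (ψ : Multigraph.Iso Γ.1 π.C.toMultigraph) :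
    ∃ (x : Marking Γ r ℓ d) (φ : TropicalCover.Iso x.cover π), Marking.graphIso φ = ψ := by
  have hcard : Fintype.card π.C.V = 2 * g - 2 := by
    rw [← Γ.card_vert]
    exact (Fintype.card_congr ψ.vert).symm
  have hex : ∀ v, ∃ i, (r i : AddCircle ℓ) = π.vmap v := fun v => by
    have h : π.vmap v ∈ Set.range fun i => (r i : AddCircle ℓ) := hπ' ▸ ⟨v, rfl⟩
    exact h
  choose idx hidx using hex
  have hsurj : Function.Surjective idx := by
    intro i
    have h : (r i : AddCircle ℓ) ∈ Set.range π.vmap := hπ' ▸ ⟨i, rfl⟩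
    obtain ⟨v, hv⟩ := h
    rw [← hidx] at hv
    exact ⟨v, hr'.injective (eq_of_coe_addCircle_eq (hr _) (hr _) hv)⟩
  -- There are as many vertices as branch points, so hitting every point makes the assignment
  -- bijective.
  have hbij : Function.Bijective idx :=
    (Fintype.bijective_iff_surjective_and_card idx).2 ⟨hsurj, by simp [hcard]⟩
  have hinj : Function.Injective π.vmap := by
    intro v w hvw
    rw [← hidx, ← hidx] at hvw
    exact hbij.1 (hr'.injective (eq_of_coe_addCircle_eq (hr _) (hr _) hvw))
  have hs := TropicalCover.slope_ne_zero hinj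
  have hb := (PreCover.balanced_iff _).1 π.balanced
  have hwind : ∀ e, ∃ n : ℤ, π.slope e * π.C.length e =
      r (idx (π.C.ends e true)) - r (idx (π.C.ends e false)) + n * ℓ := by
    intro e
    have h := π.continuous_eq e
    rw [← hidx, ← hidx, ← AddCircle.coe_add, eq_comm, coe_addCircle_eq_iff] at h
    obtain ⟨n, hn⟩ := h
    exact ⟨n, by linarith⟩
  choose n hn using hwind
  have hdeg : ∑ e, π.slope e * n e = d :=
    (PreCover.hasDegree_iff hℓ π.toPreCover (P := fun v => r (idx v)) (fun _ => hr _)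
      (fun v => (hidx v).symm) hn hs hb d).1 hπ
  -- The vertices are ordered as their images occur in `[0, ℓ)`.
  let Ω : VertexOrder Γ.1 :=
    (ψ.vert.trans (Equiv.ofBijective idx hbij)).trans (finCongr Γ.card_vert.symm)
  have hΩ : ∀ v, position Γ r Ω v = r (idx (ψ.vert v)) := fun v => by simp [position, Ω]
  have hends : ∀ e, ψ.vert (Γ.1.ends e true) = π.C.ends (ψ.edge e) (!ψ.flip e) ∧
      ψ.vert (Γ.1.ends e false) = π.C.ends (ψ.edge e) (ψ.flip e) := fun e => by
    rw [← ψ.ends_eq, ← ψ.ends_eq]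
    simp
  have hlen : ∀ e, (ψ.pull π.slope e : ℝ) * π.C.length (ψ.edge e) =
      position Γ r Ω (Γ.1.ends e true) - position Γ r Ω (Γ.1.ends e false) + ψ.pull n e * ℓ := by
    intro e
    rw [hΩ, hΩ, (hends e).1, (hends e).2]
    have := hn (ψ.edge e)
    unfold Multigraph.Iso.pull
    cases ψ.flip e
    · simpa using this
    · simp
      linarith
  have hpull : ∀ e, ψ.pull π.slope e ≠ 0 := fun e => by
    unfold Multigraph.Iso.pull
    split_ifs <;> simp [hs]
  have hflow : Γ.1.IsFlow (position Γ r Ω) ℓ fun e => (ψ.pull π.slope e, ψ.pull n e) := by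
    refine ⟨fun v => ?_, fun e => ?_⟩
    · exact (ψ.excess_pull π.slope v).trans (hb _)
    · simp only
      -- The quantity becomes the square of the slope times the length.
      rw [← hlen, ← mul_assoc]
      have h1 : (ψ.pull π.slope e : ℝ) ≠ 0 := by exact_mod_cast hpull e
      exact mul_pos (mul_self_pos.2 h1) (π.C.length_pos _)
  let x : Marking Γ r ℓ d :=
    ⟨Ω, fun e => (ψ.pull π.slope e, ψ.pull n e), hflow, (ψ.sum_pull_mul_pull _ _).trans hdeg⟩
  refine ⟨x, TropicalCover.Iso.ofGraphIso (π := x.cover) ψ (fun e => ?_) (fun v => ?_)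
    (fun e => rfl), rfl⟩
  · have h1 := slope_mul_length_coverOfFlow Γ.2.1 Γ.2.2.1 Γ.nonempty_edge hflow e
    simp only at h1
    rw [← hlen e] at h1
    have h0 : (ψ.pull π.slope e : ℝ) ≠ 0 := by exact_mod_cast hpull e
    exact (mul_left_cancel₀ h0 h1).symm
  · exact (hidx (ψ.vert v)).symm.trans (congrArg _ (hΩ v).symm)

/-- Isomorphisms from `Γ` to the source of a cover are isomorphisms from the covers given by the
markings of `Γ`. -/
lemma bijective_graphIso (hℓ : 0 < ℓ) (hr : ∀ i, r i ∈ Set.Ico 0 ℓ) (hr' : StrictMono r)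
    {π : TropicalCover ℓ} (hπ : π.HasDegree d)
    (hπ' : Set.range π.vmap = Set.range fun i => (r i : AddCircle ℓ)) :
    Function.Bijective (fun z : Σ x : Marking Γ r ℓ d, TropicalCover.Iso x.cover π =>
      Marking.graphIso z.2) := by
  constructor
  · rintro ⟨x, φ⟩ ⟨x', φ'⟩ h
    have h' : x = x' := Marking.eq_of_graphIso_eq hℓ hr hr' φ φ' h
    subst h'
    have h'' : φ = φ' := TropicalCover.Iso.toIso_injective h
    rw [h'']
  · intro ψ
    obtain ⟨x, φ, h⟩ := exists_marking hℓ hr hr' hπ hπ' ψ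
    exact ⟨⟨x, φ⟩, h⟩

end

/-! ### Counting -/

namespace Multigraph

variable {G G' G'' : Multigraph}

lemma Iso.card_eq_left (φ : Iso G G') : Nat.card (Iso G G'') = Nat.card (Iso G' G'') :=
  le_antisymm (Nat.card_le_card_of_injective _ φ.symm.trans_right_injective)
    (Nat.card_le_card_of_injective _ φ.trans_right_injective)

lemma Iso.symm_symm (φ : Iso G G') : φ.symm.symm = φ := by
  refine Iso.ext rfl rfl (funext fun e => ?_)
  simp [Iso.symm]

lemma Iso.card_comm : Nat.card (Iso G G') = Nat.card (Iso G' G) :=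
  Nat.card_congr ⟨Iso.symm, Iso.symm, Iso.symm_symm, Iso.symm_symm⟩

end Multigraph

/-- There are only finitely many Feynman graphs of a given genus. -/
lemma finite_feynmanClass (g : ℕ) : Finite (FeynmanClass g) := by
  let v : ∀ c : FeynmanClass g, (Quotient.out c).1.V ≃ Fin (2 * g - 2) := fun c =>
    Fintype.equivFinOfCardEq (Quotient.out c).card_vert
  let w : ∀ c : FeynmanClass g, (Quotient.out c).1.E ≃ Fin (3 * g - 3) := fun c =>
    Fintype.equivFinOfCardEq
      (card_edge_of_genus_eq (Quotient.out c).2.2.1 (Quotient.out c).2.2.2)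
  -- The incidence table of a graph with numbered vertices and edges determines its isomorphism
  -- class.
  refine Finite.of_injective (β := Fin (3 * g - 3) → Bool → Fin (2 * g - 2))
    (fun c e b => v c ((Quotient.out c).1.ends ((w c).symm e) b)) fun c c' h => ?_
  rw [← Quotient.out_eq c, ← Quotient.out_eq c']
  refine Quotient.sound ⟨⟨(v c).trans (v c').symm, (w c).trans (w c').symm, fun _ => false, ?_⟩⟩
  intro e b
  have := congrFun (congrFun h (w c e)) b
  simp only [Equiv.symm_apply_apply] at this
  simp [this]

/-- Distinct points of the circle have ordered representatives. -/
lemma exists_strictMono_lift {ℓ : ℝ} (hℓ : 0 < ℓ) {N : ℕ} {p : Fin N → AddCircle ℓ}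
    (hp : Function.Injective p) : ∃ r : Fin N → ℝ, StrictMono r ∧ (∀ i, r i ∈ Set.Ico 0 ℓ) ∧
      Set.range p = Set.range fun i => (r i : AddCircle ℓ) := by
  choose P hP hP' using fun i => exists_coe_addCircle_eq hℓ (p i)
  have hinj : Function.Injective P := fun i j h => hp (by rw [← hP', ← hP', h])
  refine ⟨P ∘ Tuple.sort P, (Tuple.monotone_sort P).strictMono_of_injective
    (hinj.comp (Tuple.sort P).injective), fun i => hP _, ?_⟩
  simp only [Function.comp_apply, hP']
  exact ((Tuple.sort P).surjective.range_comp p).symm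

section

variable {g d : ℕ} {ℓ : ℝ} {p : Fin (2 * g - 2) → AddCircle ℓ} {r : Fin (2 * g - 2) → ℝ}
  {Γ : FeynmanGraph g}

lemma abs_position_sub_lt (hr : ∀ i, r i ∈ Set.Ico 0 ℓ) (Ω : VertexOrder Γ.1) (v w : Γ.1.V) :
    |position Γ r Ω v - position Γ r Ω w| < ℓ := by
  have h1 : position Γ r Ω v ∈ Set.Ico 0 ℓ := hr _
  have h2 : position Γ r Ω w ∈ Set.Ico 0 ℓ := hr _
  rw [abs_lt]
  constructor <;> linarith [h1.1, h1.2, h2.1, h2.2]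

lemma Admissible.lt_iff {Ω : VertexOrder Γ.1} {τ : UpperHalfPlane} {y : Γ.1.V → ℝ}
    (hy : Admissible Ω τ y) (v w : Γ.1.V) : y v < y w ↔ Ω v < Ω w := by
  refine ⟨fun h => ?_, hy.1 v w⟩
  by_contra! h'
  rcases h'.lt_or_eq with h' | h'
  · exact lt_asymm h (hy.1 w v h')
  · rw [Ω.injective h'] at h
    exact lt_irrefl _ h

lemma Admissible.injective {Ω : VertexOrder Γ.1} {τ : UpperHalfPlane} {y : Γ.1.V → ℝ}
    (hy : Admissible Ω τ y) : Function.Injective y := by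
  intro v w h
  by_contra hne
  rcases lt_or_gt_of_ne (Ω.injective.ne hne) with h' | h'
  · exact (hy.1 _ _ h').ne h
  · exact (hy.1 _ _ h').ne h.symm

lemma Admissible.lt_iff_position {Ω : VertexOrder Γ.1} {τ : UpperHalfPlane} {y : Γ.1.V → ℝ}
    (hy : Admissible Ω τ y) (hr : StrictMono r) (v w : Γ.1.V) :
    y v < y w ↔ position Γ r Ω v < position Γ r Ω w := by
  rw [hy.lt_iff, position, position, hr.lt_iff_lt]
  rfl

lemma finite_marking {τ : UpperHalfPlane} {y : VertexOrder Γ.1 → Γ.1.V → ℝ}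
    (hy : ∀ Ω, Admissible Ω τ (y Ω)) (hr : ∀ i, r i ∈ Set.Ico 0 ℓ) (hr' : StrictMono r) :
    Finite (Marking Γ r ℓ d) := by
  have : ∀ Ω : VertexOrder Γ.1, Finite (Flows Γ.1 (position Γ r Ω) ℓ d) := fun Ω =>
    finite_flows Γ.2.2.1 (hy Ω).injective (hy Ω).2 (abs_position_sub_lt hr Ω)
      ((hy Ω).lt_iff_position hr') d
  infer_instance

open Classical in
/-- The number of all markings, counted with the product of the slopes. -/
def markingCount (Γ : FeynmanGraph g) (r : Fin (2 * g - 2) → ℝ) (ℓ : ℝ) (d : ℕ) : ℚ :=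
  ∑ Ω : VertexOrder Γ.1, flowCount Γ.1 (position Γ r Ω) ℓ d

lemma hasSum_markingCount {τ : UpperHalfPlane} {y : VertexOrder Γ.1 → Γ.1.V → ℝ}
    (hy : ∀ Ω, Admissible Ω τ (y Ω)) (hr : ∀ i, r i ∈ Set.Ico 0 ℓ) (hr' : StrictMono r) :
    HasSum (fun d : ℕ => (markingCount Γ r ℓ d : ℂ) * expTwoPi τ ^ d)
      (feynmanSum Γ.1 y τ) := by
  have := Γ.nonempty_edge
  unfold feynmanSum markingCount
  simp only [Rat.cast_sum, Finset.sum_mul]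
  exact hasSum_sum fun Ω _ => hasSum_flowCount Γ.2.2.1 (hy Ω).injective (hy Ω).2
    (abs_position_sub_lt hr Ω) ((hy Ω).lt_iff_position hr')

lemma markingCount_zero (hℓ : 0 < ℓ) : markingCount Γ r ℓ 0 = 0 := by
  have := Γ.nonempty_edge
  exact Finset.sum_eq_zero fun Ω _ => flowCount_zero hℓ

lemma markingCount_eq_sum [Fintype (Marking Γ r ℓ d)] :
    markingCount Γ r ℓ d = ∑ x : Marking Γ r ℓ d, ∏ e, (x.cover.weight e : ℚ) := by
  classical
  have hf : ∀ Ω : VertexOrder Γ.1, Finite (Flows Γ.1 (position Γ r Ω) ℓ d) := fun Ω =>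
    Finite.of_injective (fun a => (⟨Ω, a⟩ : Marking Γ r ℓ d)) fun _ _ h => eq_of_heq (Sigma.mk.inj h).2
  let _ : ∀ Ω : VertexOrder Γ.1, Fintype (Flows Γ.1 (position Γ r Ω) ℓ d) :=
    fun Ω => Fintype.ofFinite _
  rw [markingCount]
  simp only [flowCount, finsum_eq_sum_of_fintype]
  convert (Fintype.sum_sigma (fun x : Marking Γ r ℓ d => ∏ e, (x.cover.weight e : ℚ))).symm using 1
  · exact Finset.sum_congr (by congr!) fun Ω _ => Finset.sum_congr rfl fun a _ => rfl
  · congr!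

variable (hℓ : 0 < ℓ) (hr : ∀ i, r i ∈ Set.Ico 0 ℓ)
  (hp : Set.range p = Set.range fun i => (r i : AddCircle ℓ))

/-- The cover given by a marking. -/
def Marking.toCover (x : Marking Γ r ℓ d) : Cover ℓ g p d :=
  ⟨x.cover, by
    rw [hp]
    exact x.cover_prop hℓ hr⟩

/-- The isomorphism class of the cover given by a marking. -/
def Marking.toClass (x : Marking Γ r ℓ d) : CoverClass ℓ g p d :=
  Quotient.mk _ (x.toCover hℓ hr hp)

lemma Marking.toClass_eq_iff (x : Marking Γ r ℓ d) (c : CoverClass ℓ g p d) :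
    x.toClass hℓ hr hp = c ↔ Nonempty (TropicalCover.Iso x.cover (Quotient.out c).1) := by
  have h : Quotient.mk _ (Quotient.out c) = c := Quotient.out_eq c
  conv_lhs => rw [← h]
  exact Quotient.eq

end

/-! ### Passing between markings, covers and graphs by counting isomorphisms -/

section

variable {g d : ℕ} {ℓ : ℝ} {p : Fin (2 * g - 2) → AddCircle ℓ} {r : Fin (2 * g - 2) → ℝ}
  {Γ : FeynmanGraph g}

/-- Count the pairs of a marking and an isomorphism from its cover to the representative of `c`: a
marking in the fibre has as many isomorphisms as there are automorphisms, any other has none. By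
`bijective_graphIso` the pairs are the graph isomorphisms. -/
lemma card_fiber_mul_card_iso (hℓ : 0 < ℓ) (hr : ∀ i, r i ∈ Set.Ico 0 ℓ) (hr' : StrictMono r)
    (hp : Set.range p = Set.range fun i => (r i : AddCircle ℓ))
    [Finite (Marking Γ r ℓ d)] (c : CoverClass ℓ g p d) :
    Nat.card {x : Marking Γ r ℓ d // x.toClass hℓ hr hp = c} *
      Nat.card (TropicalCover.Iso (Quotient.out c).1 (Quotient.out c).1) =
      Nat.card (Multigraph.Iso Γ.1 (Quotient.out c).1.C.toMultigraph) := by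
  classical
  let _ := Fintype.ofFinite (Marking Γ r ℓ d)
  have hc := (Quotient.out c).2
  rw [← Nat.card_eq_of_bijective _ (bijective_graphIso (Γ := Γ) hℓ hr hr' hc.2.1 (hc.2.2.trans hp)),
    Nat.card_sigma, Nat.card_eq_fintype_card, Fintype.card_subtype, ← smul_eq_mul,
    ← Finset.sum_const, Finset.sum_filter]
  refine Finset.sum_congr rfl fun x _ => ?_
  split_ifs with h
  · obtain ⟨φ⟩ := (x.toClass_eq_iff hℓ hr hp c).1 h
    exact φ.card_eq.symm
  · rw [x.toClass_eq_iff hℓ hr hp c, not_nonempty_iff] at h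
    exact Nat.card_of_isEmpty.symm

lemma markingCount_eq_sum_mult (hℓ : 0 < ℓ) (hr : ∀ i, r i ∈ Set.Ico 0 ℓ) (hr' : StrictMono r)
    (hp : Set.range p = Set.range fun i => (r i : AddCircle ℓ))
    [Finite (Marking Γ r ℓ d)] [Fintype (CoverClass ℓ g p d)] :
    markingCount Γ r ℓ d = ∑ c : CoverClass ℓ g p d, (Quotient.out c).1.mult *
      Nat.card (Multigraph.Iso Γ.1 (Quotient.out c).1.C.toMultigraph) := by
  classical
  let _ := Fintype.ofFinite (Marking Γ r ℓ d)
  rw [markingCount_eq_sum, ← Finset.sum_fiberwise (s := Finset.univ)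
    (g := fun x : Marking Γ r ℓ d => x.toClass hℓ hr hp)]
  refine Finset.sum_congr rfl fun c _ => ?_
  have h1 : ∀ x ∈ Finset.univ.filter fun x : Marking Γ r ℓ d => x.toClass hℓ hr hp = c,
      ∏ e, (x.cover.weight e : ℚ) = ∏ e, ((Quotient.out c).1.weight e : ℚ) := by
    intro x hx
    obtain ⟨φ⟩ := (x.toClass_eq_iff hℓ hr hp c).1 (Finset.mem_filter.1 hx).2
    exact φ.prod_weight_eq hℓ
  have h2 : (Nat.card (TropicalCover.Iso (Quotient.out c).1 (Quotient.out c).1) : ℚ) ≠ 0 := by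
    have : Nonempty (TropicalCover.Iso (Quotient.out c).1 (Quotient.out c).1) :=
      ⟨TropicalCover.Iso.refl _⟩
    exact_mod_cast Nat.card_pos.ne'
  rw [Finset.sum_congr rfl h1, Finset.sum_const, nsmul_eq_mul,
    ← card_fiber_mul_card_iso hℓ hr hr' hp c, TropicalCover.mult, ← Fintype.card_subtype,
    ← Nat.card_eq_fintype_card]
  push_cast
  field_simp

/-- The source of a cover, as a Feynman graph. -/
def Cover.source (π : Cover ℓ g p d) : FeynmanGraph g :=
  ⟨π.1.C.toMultigraph, π.1.C.connected, π.1.C.trivalent, π.2.1⟩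

/-- The isomorphism class of a Feynman graph. -/
def FeynmanGraph.toClass (Γ : FeynmanGraph g) : FeynmanClass g := Quotient.mk _ Γ

lemma FeynmanGraph.toClass_eq_iff {Γ Γ' : FeynmanGraph g} :
    Γ.toClass = Γ'.toClass ↔ Nonempty (Multigraph.Iso Γ.1 Γ'.1) :=
  Quotient.eq

lemma nonempty_iso_ref_iff {ref : FeynmanClass g → FeynmanGraph g}
    (href : ∀ c, (ref c).toClass = c) (γ : FeynmanClass g) (Γ : FeynmanGraph g) :
    Nonempty (Multigraph.Iso (ref γ).1 Γ.1) ↔ γ = Γ.toClass := by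
  rw [← FeynmanGraph.toClass_eq_iff, href]

/-- The source of a cover is isomorphic to some reference graph, and such an isomorphism comes from
a marking of it. -/
lemma finite_coverClass (hℓ : 0 < ℓ) (hr : ∀ i, r i ∈ Set.Ico 0 ℓ) (hr' : StrictMono r)
    (hp : Set.range p = Set.range fun i => (r i : AddCircle ℓ))
    {ref : FeynmanClass g → FeynmanGraph g} (href : ∀ c, (ref c).toClass = c)
    [∀ γ, Finite (Marking (ref γ) r ℓ d)] : Finite (CoverClass ℓ g p d) := by
  have := finite_feynmanClass g
  refine Finite.of_surjective (fun x : Σ γ, Marking (ref γ) r ℓ d => x.2.toClass hℓ hr hp) fun c => ?_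
  have hc := (Quotient.out c).2
  obtain ⟨ψ⟩ := (nonempty_iso_ref_iff href (Quotient.out c).source.toClass _).2 rfl
  obtain ⟨x, φ, _⟩ := exists_marking hℓ hr hr' hc.2.1 (hc.2.2.trans hp) ψ
  exact ⟨⟨_, x⟩, (x.toClass_eq_iff hℓ hr hp c).2 ⟨φ⟩⟩

/-- Only the class of `Γ` contributes, and there the isomorphisms are as many as the automorphisms.
-/
lemma sum_card_iso_ref_div {ref : FeynmanClass g → FeynmanGraph g} (href : ∀ c, (ref c).toClass = c)
    [Fintype (FeynmanClass g)] (Γ : FeynmanGraph g) :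
    ∑ γ, (Nat.card (Multigraph.Iso (ref γ).1 Γ.1) : ℚ) /
      Nat.card (Multigraph.Iso (ref γ).1 (ref γ).1) = 1 := by
  refine (Finset.sum_eq_single Γ.toClass (fun γ _ hγ => ?_) fun h => absurd (Finset.mem_univ _) h).trans ?_
  · rw [ne_eq, ← nonempty_iso_ref_iff href, not_nonempty_iff] at hγ
    rw [Nat.card_of_isEmpty, Nat.cast_zero, zero_div]
  · obtain ⟨φ⟩ := (nonempty_iso_ref_iff href Γ.toClass Γ).2 rfl
    have h1 : Nat.card (Multigraph.Iso (ref Γ.toClass).1 (ref Γ.toClass).1) =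
        Nat.card (Multigraph.Iso (ref Γ.toClass).1 Γ.1) :=
      φ.card_eq_left.trans Multigraph.Iso.card_comm
    rw [h1]
    have : Nonempty (Multigraph.Iso (ref Γ.toClass).1 Γ.1) := ⟨φ⟩
    exact div_self (by exact_mod_cast Nat.card_pos.ne')

/-- After exchanging the sums over graphs and covers, the inner sum of `sum_card_iso_ref_div` is `1`
for each cover. -/
lemma tropicalHurwitz_eq_sum (hℓ : 0 < ℓ) (hr : ∀ i, r i ∈ Set.Ico 0 ℓ) (hr' : StrictMono r)
    (hp : Set.range p = Set.range fun i => (r i : AddCircle ℓ))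
    {ref : FeynmanClass g → FeynmanGraph g} (href : ∀ c, (ref c).toClass = c)
    [Fintype (FeynmanClass g)] [∀ γ, Finite (Marking (ref γ) r ℓ d)] :
    tropicalHurwitz ℓ g p d = ∑ γ, markingCount (ref γ) r ℓ d *
      (1 / Nat.card (Multigraph.Iso (ref γ).1 (ref γ).1)) := by
  have := finite_coverClass (p := p) (d := d) hℓ hr hr' hp href
  let _ := Fintype.ofFinite (CoverClass ℓ g p d)
  rw [tropicalHurwitz, finsum_eq_sum_of_fintype]
  refine Eq.trans ?_ (Finset.sum_congr rfl fun γ _ => by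
    rw [markingCount_eq_sum_mult hℓ hr hr' hp, Finset.sum_mul])
  rw [Finset.sum_comm]
  refine Finset.sum_congr rfl fun c _ => ?_
  have h := sum_card_iso_ref_div href (Quotient.out c).source
  conv_lhs => rw [← mul_one (Quotient.out c).1.mult, ← h, Finset.mul_sum]
  refine Finset.sum_congr rfl fun γ _ => ?_
  simp only [Cover.source]
  ring

end

end TropMirror

end

/-- For `g > 1`, a tropical elliptic curve of any length `ℓ`, pairwise distinct branch points `p`,
any choice `ref` of a representative of every isomorphism class of Feynman graphs, and any
admissible starting points `y`: the counts are finite, and the generating series of the tropical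
Hurwitz numbers converges to the weighted sum of the Feynman integrals. -/
theorem mainTheorem2 (g : ℕ) (hg : 1 < g) (ℓ : ℝ) (hℓ : 0 < ℓ)
    (p : Fin (2 * g - 2) → AddCircle ℓ) (hp : Function.Injective p)
    (ref : TropMirror.FeynmanClass g → TropMirror.FeynmanGraph g)
    (href : ∀ c, Quotient.mk _ (ref c) = c)
    (τ : UpperHalfPlane)
    (y : ∀ c : TropMirror.FeynmanClass g,
      TropMirror.VertexOrder (ref c).1 → (ref c).1.V → ℝ)
    (hy : ∀ c Ω, TropMirror.Admissible Ω τ (y c Ω)) :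
    (∀ d, Finite (TropMirror.CoverClass ℓ g p d)) ∧ Finite (TropMirror.FeynmanClass g) ∧
    HasSum
      (fun d : ℕ =>
        (TropMirror.tropicalHurwitz ℓ g p (d + 1) : ℂ) * TropMirror.nome τ ^ (2 * (d + 1)))
      (∑ᶠ c : TropMirror.FeynmanClass g,
        TropMirror.feynmanSum (ref c).1 (y c) τ *
          (1 / (Nat.card (TropMirror.Multigraph.Iso (ref c).1 (ref c).1) : ℂ))) := by
  obtain ⟨r, hr', hr, hrange⟩ := TropMirror.exists_strictMono_lift hℓ hp
  have hM : ∀ d γ, Finite (TropMirror.Marking (ref γ) r ℓ d) := fun d γ =>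
    TropMirror.finite_marking (hy γ) hr hr'
  have hF := TropMirror.finite_feynmanClass g
  refine ⟨fun d => TropMirror.finite_coverClass hℓ hr hr' hrange href, hF, ?_⟩
  let _ := Fintype.ofFinite (TropMirror.FeynmanClass g)
  have h : HasSum (fun d : ℕ => (TropMirror.tropicalHurwitz ℓ g p d : ℂ) * TropMirror.expTwoPi τ ^ d)
      (∑ c : TropMirror.FeynmanClass g, TropMirror.feynmanSum (ref c).1 (y c) τ *
          (1 / (Nat.card (TropMirror.Multigraph.Iso (ref c).1 (ref c).1) : ℂ))) := by
    refine (hasSum_sum fun γ _ => (TropMirror.hasSum_markingCount (hy γ) hr hr').mul_right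
      (1 / (Nat.card (TropMirror.Multigraph.Iso (ref γ).1 (ref γ).1) : ℂ))).congr_fun fun d => ?_
    rw [TropMirror.tropicalHurwitz_eq_sum hℓ hr hr' hrange href, Rat.cast_sum, Finset.sum_mul]
    refine Finset.sum_congr rfl fun γ _ => ?_
    push_cast
    ring
  -- Every flow makes at least one turn, so the series may start at degree one.
  have h0 : TropMirror.tropicalHurwitz ℓ g p 0 = 0 := by
    rw [TropMirror.tropicalHurwitz_eq_sum hℓ hr hr' hrange href]
    exact Finset.sum_eq_zero fun γ _ => by rw [TropMirror.markingCount_zero hℓ, zero_mul]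
  rw [finsum_eq_sum_of_fintype]
  rw [← hasSum_nat_add_iff' 1] at h
  simpa [h0, pow_mul, TropMirror.nome_sq] using h
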